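/- For $n\ge 1$ let $\mathrm{Spin}(2n)$ be the matchgate group on $n$ qubits, i.e. the compact group of unitaries generated by the gates $e^{i\theta Z_i}$ ($1\le i\le n$) and $e^{i\theta X_iX_{i+1}}$ ($1\le i<n$), $\theta\in\mathbb R$, and let $\mu_{\mathrm{Spin}(2n)}$ be its normalized Haar measure. Its Lie algebra is $\mathfrak{so}(2n)\cong\mathrm{span}_{\mathbb R}\, i\{Z_i,\ A_iZ_{i+1}\cdots Z_{j-1}B_j : 1\le i<j\le n \text{ (for the second kind)},\ A,B\in\{X,Y\}\}$. An $N$-gate non-local matchgate circuit is a unitary $U=\prod_{\ell=1}^{N}\exp(i\vartheta_\ell H_\ell)$ with $\vartheta_\ell\in\mathbb R$ and each $H_\ell$ an arbitrary Pauli string with $iH_\ell\in\mathfrak{so}(2n)$; an $N$-gate ensemble is a Borel probability measure $\mathcal E$ on the unitary group that is supported on such circuits. For an ensemble $\mathcal E$ let $\phi^{(2)}_{\mathcal E}(\rho)=\mathbb E_{U\sim\mathcal E}[U^{\otimes 2}\rho\,(U^\dagger)^{\otimes 2}]$, and let $\|\Phi\|_\diamond=\sup_{m,\rho}\|(\Phi\otimes\mathrm{id}_{\mathbb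 C^m})(\rho)\|_1$, where $\rho$ runs over the quantum states on the system together with an ancilla $\mathbb C^m$. (a) For every real $c>2$ there are constants $b>1$ and $K>0$, depending only on $c$, such that for all $n\ge1$, all $N\le n/c$ and every $N$-gate ensemble $\mathcal E_N$ of non-local matchgate circuits on $n$ qubits, $$\big\|\phi^{(2)}_{\mathcal E_N}-\phi^{(2)}_{\mu_{\mathrm{Spin}(2n)}}\big\|_\diamond\ \ge\ 2-K\sqrt n\,b^{-n}.$$ (b) Consequently no ensemble of circuits with sublinearly many gates approximates the second moment of the matchgate Haar measure: if $N(n)=o(n)$ and $\varepsilon<2$, then for all sufficiently large $n$ no $N(n)$-gate ensemble of non-local matchgate circuits on $n$ qubits is an additive $\varepsilon$-approximate $2$-design over $\mathrm{Spin}(2n)$, i.e. $\|\phi^{(2)}_{\mathcal E}-\phi^{(2)}_{\mu_{\mathrm{Spin}(2n)}}\|_\diamond>\varepsilon$ for every such $\mathcal E$. -/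

import Mathlib

noncomputable section

namespace Matchgate

open scoped Kronecker Matrix ENNReal Topology ComplexOrder
open MeasureTheory

/-! ### Trace norm and diamond norm -/

/-- The trace norm `‖A‖₁ = Tr √(A† A)`: the sum of the singular values of `A`. -/
def traceNorm {ι : Type*} [Fintype ι] [DecidableEq ι] (A : Matrix ι ι ℂ) : ℝ :=
  ∑ i, √((Matrix.isHermitian_conjTranspose_mul_self A).eigenvalues i)

/-- Quantum states (density matrices): positive semidefinite matrices of trace one. -/
def IsState {ι : Type*} [Fintype ι] (ρ : Matrix ι ι ℂ) : Prop :=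
  ρ.PosSemidef ∧ ρ.trace = 1

/-- The map `Φ ⊗ id` on operators on `ℂ^ι ⊗ ℂ^m`: `Φ` is applied to every block of `ρ`
indexed by a pair of basis vectors of the ancilla `ℂ^m`. -/
def ampliate {ι : Type*} (Φ : Matrix ι ι ℂ →ₗ[ℂ] Matrix ι ι ℂ) (m : ℕ)
    (ρ : Matrix (ι × Fin m) (ι × Fin m) ℂ) : Matrix (ι × Fin m) (ι × Fin m) ℂ :=
  Matrix.of fun a b => Φ (Matrix.of fun i j => ρ (i, a.2) (j, b.2)) a.1 b.1

/-- The diamond norm of a (Hermiticity-preserving) linear map on operators: the supremum of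
`‖(Φ ⊗ id) ρ‖₁` over all ancilla dimensions and all quantum states `ρ`. It takes values in
`[0, ∞]`, so that the supremum is meaningful without a boundedness proof. -/
def diamondNorm {ι : Type*} [Fintype ι] [DecidableEq ι]
    (Φ : Matrix ι ι ℂ →ₗ[ℂ] Matrix ι ι ℂ) : ℝ≥0∞ :=
  ⨆ (m : ℕ) (ρ : Matrix (ι × Fin m) (ι × Fin m) ℂ) (_ : IsState ρ),
    ENNReal.ofReal (traceNorm (ampliate Φ m ρ))

/-! ### Ensembles of unitaries and their second moments -/

/-- The computational basis of `n` qubits. -/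
abbrev Qubits (n : ℕ) : Type := Fin n → Fin 2

/-- Operators on `n` qubits, as matrices in the computational basis. -/
abbrev Op (n : ℕ) : Type := Matrix (Qubits n) (Qubits n) ℂ

/-- The group of `n`-qubit unitaries, with the topology of matrices. -/
abbrev UGroup (n : ℕ) : Type := Matrix.unitaryGroup (Qubits n) ℂ

/-- The Borel `σ`-algebra on the unitary group. -/
instance instMeasurableSpaceUGroup (n : ℕ) : MeasurableSpace (UGroup n) := borel _

instance instBorelSpaceUGroup (n : ℕ) : BorelSpace (UGroup n) := ⟨rfl⟩

instance instCompactSpaceUGroup (n : ℕ) : CompactSpace (UGroup n) := by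
  have hsub : (↑(Matrix.unitaryGroup (Qubits n) ℂ) : Set (Op n)) ⊆
      Set.univ.pi fun _ => Set.univ.pi fun _ => Metric.closedBall (0 : ℂ) 1 := by
    intro U hU i _ j _
    simpa using entry_norm_bound_of_unitary hU i j
  have hcpt : IsCompact (Set.univ.pi fun _ : Qubits n => Set.univ.pi fun _ : Qubits n =>
      Metric.closedBall (0 : ℂ) 1) :=
    isCompact_univ_pi fun _ => isCompact_univ_pi fun _ => isCompact_closedBall _ _
  exact isCompact_iff_compactSpace.mp (hcpt.of_isClosed_subset (isClosed_unitary (R := Op n)) hsub)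

/-- The two-copy operator `U ⊗ U`. -/
def twoCopies {n : ℕ} (U : UGroup n) : Matrix (Qubits n × Qubits n) (Qubits n × Qubits n) ℂ :=
  (U : Op n) ⊗ₖ (U : Op n)

lemma continuous_conj_entry {n : ℕ} (ρ : Matrix (Qubits n × Qubits n) (Qubits n × Qubits n) ℂ)
    (a b : Qubits n × Qubits n) :
    Continuous fun U : UGroup n => (twoCopies U * ρ * (twoCopies U)ᴴ) a b := by
  have h : ∀ x y : Qubits n × Qubits n, Continuous fun U : UGroup n => twoCopies U x y := by
    intro x y
    have h1 : ∀ i j : Qubits n, Continuous fun U : UGroup n => (U : Op n) i j := fun i j =>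
      continuous_subtype_val.matrix_elem i j
    exact (h1 x.1 y.1).mul (h1 x.2 y.2)
  simp only [Matrix.mul_apply, Matrix.conjTranspose_apply]
  exact continuous_finsetSum _ fun j _ =>
    (continuous_finsetSum _ fun k _ => (h a k).mul continuous_const).mul (h b j).star

lemma integrable_conj_entry {n : ℕ} (E : Measure (UGroup n)) [IsFiniteMeasure E]
    (ρ : Matrix (Qubits n × Qubits n) (Qubits n × Qubits n) ℂ) (a b : Qubits n × Qubits n) :
    Integrable (fun U : UGroup n => (twoCopies U * ρ * (twoCopies U)ᴴ) a b) E :=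
  (continuous_conj_entry ρ a b).integrable_of_hasCompactSupport
    (HasCompactSupport.of_compactSpace _)

/-- The second moment channel `ρ ↦ 𝔼_{U ∼ E} [U^{⊗2} ρ (U†)^{⊗2}]` of an ensemble of unitaries,
given as a Borel probability measure `E` on the unitary group. -/
def secondMoment {n : ℕ} (E : Measure (UGroup n)) [IsProbabilityMeasure E] :
    Matrix (Qubits n × Qubits n) (Qubits n × Qubits n) ℂ →ₗ[ℂ]
      Matrix (Qubits n × Qubits n) (Qubits n × Qubits n) ℂ where
  toFun ρ := Matrix.of fun a b => ∫ U, (twoCopies U * ρ * (twoCopies U)ᴴ) a b ∂E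
  map_add' ρ σ := by
    ext a b
    simp only [Matrix.of_apply, Matrix.add_apply, Matrix.mul_add, Matrix.add_mul]
    exact integral_add (integrable_conj_entry E ρ a b) (integrable_conj_entry E σ a b)
  map_smul' c ρ := by
    ext a b
    simp only [Matrix.of_apply, Matrix.smul_apply, Matrix.mul_smul, Matrix.smul_mul,
      RingHom.id_apply]
    exact integral_smul c _

/-- The uniform (Haar) ensemble over a closed subgroup `G` of the unitary group: the normalized
Haar measure of the compact group `G`, regarded as a measure on all unitaries. -/
def haarEnsemble {n : ℕ} (G : Subgroup (UGroup n)) [CompactSpace G] : Measure (UGroup n) :=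
  (Measure.haarMeasure (⊤ : TopologicalSpace.PositiveCompacts G)).map Subtype.val

instance instIsProbabilityMeasureHaarEnsemble {n : ℕ} (G : Subgroup (UGroup n))
    [CompactSpace G] : IsProbabilityMeasure (haarEnsemble G) := by
  have : IsProbabilityMeasure (Measure.haarMeasure (⊤ : TopologicalSpace.PositiveCompacts G)) :=
    ⟨by simpa using Measure.haarMeasure_self (K₀ := (⊤ : TopologicalSpace.PositiveCompacts G))⟩
  exact Measure.isProbabilityMeasure_map measurable_subtype_coe.aemeasurable

/-- The ensemble `E` is an additive `ε`-approximate `2`-design over the compact group `G`. -/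
def IsApproxTwoDesign {n : ℕ} (G : Subgroup (UGroup n)) [CompactSpace G]
    (E : Measure (UGroup n)) [IsProbabilityMeasure E] (ε : ℝ) : Prop :=
  diamondNorm (secondMoment E - secondMoment (haarEnsemble G)) ≤ ENNReal.ofReal ε

/-! ### Pauli strings, the matchgate Lie algebra and the matchgate group -/

/-- Labels of the single-qubit Pauli matrices. -/
inductive Pauli
  | I
  | X
  | Y
  | Z

/-- The single-qubit Pauli matrices. -/
def Pauli.toMatrix : Pauli → Matrix (Fin 2) (Fin 2) ℂ
  | Pauli.I => 1
  | Pauli.X => !![0, 1; 1, 0]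
  | Pauli.Y => !![0, -Complex.I; Complex.I, 0]
  | Pauli.Z => !![1, 0; 0, -1]

/-- The Pauli string `s 0 ⊗ s 1 ⊗ ⋯ ⊗ s (n - 1)` as an operator on `n` qubits. -/
def pauliString {n : ℕ} (s : Fin n → Pauli) : Op n :=
  Matrix.of fun x y => ∏ k, (s k).toMatrix (x k) (y k)

/-- The Pauli string `Z_i`. -/
def stringZ {n : ℕ} (i : Fin n) : Fin n → Pauli :=
  fun k => if k = i then Pauli.Z else Pauli.I

/-- For `i < j`, the Pauli string `A_i Z_{i+1} ⋯ Z_{j-1} B_j`. -/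
def stringHat {n : ℕ} (A B : Pauli) (i j : Fin n) : Fin n → Pauli :=
  fun k => if k = i then A else if k = j then B else
    if i < k ∧ k < j then Pauli.Z else Pauli.I

/-- The Pauli strings `Z_i` and `A_i Z_{i+1} ⋯ Z_{j-1} B_j`, with `A, B ∈ {X, Y}` and `i < j`. -/
def matchgateStrings (n : ℕ) : Set (Op n) :=
  {H | (∃ i : Fin n, H = pauliString (stringZ i)) ∨
    ∃ A B : Pauli, (A = Pauli.X ∨ A = Pauli.Y) ∧ (B = Pauli.X ∨ B = Pauli.Y) ∧
      ∃ i j : Fin n, i < j ∧ H = pauliString (stringHat A B i j)}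

/-- The matchgate Lie algebra `𝔰𝔬(2n)`, as a real space of skew-Hermitian operators: the real span
of `i Z_i` and `i A_i Z_{i+1} ⋯ Z_{j-1} B_j`, with `A, B ∈ {X, Y}` and `i < j`. -/
def matchgateLieAlgebra (n : ℕ) : Submodule ℝ (Op n) :=
  Submodule.span ℝ ((fun H => Complex.I • H) '' matchgateStrings n)

/-- The rotation gate `exp (i θ H)`. -/
def gate {n : ℕ} (θ : ℝ) (H : Op n) : Op n :=
  NormedSpace.exp ((Complex.I * (θ : ℂ)) • H)

/-- The generators of the matchgate group: the single-qubit gates `exp (i θ Z_i)` and the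
nearest-neighbour gates `exp (i θ X_i X_{i+1})`. -/
def matchgateGenerators (n : ℕ) : Set (UGroup n) :=
  {U | ∃ θ : ℝ, (∃ i : Fin n, (U : Op n) = gate θ (pauliString (stringZ i))) ∨
    ∃ i j : Fin n, (i : ℕ) + 1 = j ∧
      (U : Op n) = gate θ (pauliString (stringHat Pauli.X Pauli.X i j))}

/-- The matchgate group `Spin(2n)`: the compact group of unitaries generated by the single-qubit
`Z` gates and the nearest-neighbour `XX` gates, i.e. the smallest closed subgroup of the unitary
group that contains them. (The abstract group generated by them is already closed.) -/
def matchgateGroup (n : ℕ) : Subgroup (UGroup n) :=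
  (Subgroup.closure (matchgateGenerators n)).topologicalClosure

instance instCompactSpaceMatchgateGroup (n : ℕ) : CompactSpace (matchgateGroup n) :=
  isCompact_iff_compactSpace.mp
    (Subgroup.isClosed_topologicalClosure (Subgroup.closure (matchgateGenerators n))).isCompact

/-- The unitary `U` is an `N`-gate non-local matchgate circuit: `U = ∏_{ℓ=1}^N exp (i θ_ℓ H_ℓ)`,
where the `H_ℓ` are arbitrary `n`-qubit Pauli strings in the matchgate Lie algebra. -/
def IsCircuit (n N : ℕ) (U : UGroup n) : Prop :=
  ∃ (θ : Fin N → ℝ) (s : Fin N → Fin n → Pauli),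
    (∀ l, Complex.I • pauliString (s l) ∈ matchgateLieAlgebra n) ∧
    (U : Op n) = (List.ofFn fun l => gate (θ l) (pauliString (s l))).prod

/-- The ensemble `E` is supported on `N`-gate non-local matchgate circuits. -/
def IsCircuitEnsemble (n N : ℕ) (E : Measure (UGroup n)) : Prop :=
  ∀ᵐ U ∂E, IsCircuit n N U

/-- The diamond distance between the second moment channels of the ensemble `E` and of the uniform
(Haar) ensemble over the matchgate group. -/
def distanceToMatchgateHaar {n : ℕ} (E : Measure (UGroup n)) [IsProbabilityMeasure E] : ℝ≥0∞ :=
  diamondNorm (secondMoment E - secondMoment (haarEnsemble (matchgateGroup n)))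

end Matchgate

end

/-! The `2n` Majorana operators `γ_μ` are anticommuting Hermitian involutions, and a matchgate Pauli
string is `± i γ_μ γ_ν` with `μ ≠ ν`. On two copies the operators `γ_μ ⊗ γ_μ` (`pairing`) commute,
so the two-copy space splits into joint eigenspaces labelled by the set `S` of those `μ` with
eigenvalue `1`; `proj S` projects onto them.

A gate turns the plane of `γ_μ` and `γ_ν`. Doubled, it commutes with every other pairing and with
the sum of all pairings, so it keeps `S.card` and alters `S` by at most one exchange
(`proj_mul_dbl_rotation_mul_proj`). The maximally entangled state lies in a single eigenspace,
labelled by a set of size `n`. After `N` gates it is therefore supported on `ball n N`, the sets of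
size `n` at most `N` exchanges away (`IsCircuit.ballProj_mul`).

Haar averaging behaves oppositely. Quarter turns of the generators induce adjacent transpositions of
the labels, so by invariance the Haar weight of `S` depends only on its size and is at most `1 / (2n
choose n)` when that size is `n` (`haarWeight_mul_choose_le`). Testing with the unitary `2P - 1`,
where `P = ballProj n N`, bounds the diamond distance below by `2 - 2 |ball n N| / (2n choose n)`.

It remains to count. For `0 < t ≤ 1` a generating function gives `|ball n N| t^(2N) ≤ (1 + t)^(2n)`,
while `2n choose n ≥ 4^n / (2n)`. If `N ≤ n / c` with `c > 2`, some `t` slightly below `1` makes the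
ratio exponentially small. A sublinear `N` is eventually at most `n / 3`, which gives the second
claim. -/

noncomputable section

namespace Matchgate

open scoped Kronecker Matrix ENNReal Topology ComplexOrder symmDiff
open MeasureTheory

/-! ### Tensor products of single-qubit operators -/

/-- The tensor product `M 0 ⊗ ⋯ ⊗ M (n - 1)` of single-qubit operators. -/
def tensor {n : ℕ} (M : Fin n → Matrix (Fin 2) (Fin 2) ℂ) : Op n :=
  Matrix.of fun x y => ∏ k, M k (x k) (y k)

lemma pauliString_eq_tensor {n : ℕ} (s : Fin n → Pauli) :
    pauliString s = tensor fun k => (s k).toMatrix := rfl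

lemma tensor_mul {n : ℕ} (M M' : Fin n → Matrix (Fin 2) (Fin 2) ℂ) :
    tensor M * tensor M' = tensor fun k => M k * M' k := by
  ext x y
  simp only [tensor, Matrix.mul_apply, Matrix.of_apply, ← Finset.prod_mul_distrib]
  rw [Finset.prod_univ_sum, Fintype.piFinset_univ]

lemma tensor_smul {n : ℕ} (c : Fin n → ℂ) (M : Fin n → Matrix (Fin 2) (Fin 2) ℂ) :
    (tensor fun k => c k • M k) = (∏ k, c k) • tensor M := by
  ext x y
  simp [tensor, Finset.prod_mul_distrib]

lemma tensor_one {n : ℕ} : (tensor fun _ : Fin n => 1) = 1 := by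
  ext x y
  simp only [tensor, Matrix.of_apply, Matrix.one_apply]
  by_cases h : x = y
  · simp [h]
  · obtain ⟨k, hk⟩ := Function.ne_iff.mp h
    rw [if_neg h]
    exact Finset.prod_eq_zero (Finset.mem_univ k) (if_neg hk)

lemma trace_tensor {n : ℕ} (M : Fin n → Matrix (Fin 2) (Fin 2) ℂ) :
    (tensor M).trace = ∏ k, (M k).trace := by
  simp only [tensor, Matrix.trace, Matrix.diag, Matrix.of_apply]
  rw [Finset.prod_univ_sum, Fintype.piFinset_univ]

lemma conjTranspose_tensor {n : ℕ} (M : Fin n → Matrix (Fin 2) (Fin 2) ℂ) :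
    (tensor M)ᴴ = tensor fun k => (M k)ᴴ := by
  ext x y
  simp [tensor, Matrix.conjTranspose_apply]

lemma transpose_tensor {n : ℕ} (M : Fin n → Matrix (Fin 2) (Fin 2) ℂ) :
    (tensor M)ᵀ = tensor fun k => (M k)ᵀ := by
  ext x y
  simp [tensor, Matrix.transpose_apply]

/-! ### Single-qubit Pauli matrices -/

lemma Pauli.toMatrix_mul_self (p : Pauli) : p.toMatrix * p.toMatrix = 1 := by
  cases p <;> ext i j <;> fin_cases i <;> fin_cases j <;> simp [Pauli.toMatrix]

lemma Pauli.conjTranspose_toMatrix (p : Pauli) : p.toMatrixᴴ = p.toMatrix := by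
  cases p <;> ext i j <;> fin_cases i <;> fin_cases j <;>
    simp [Pauli.toMatrix, Matrix.conjTranspose_apply]

lemma Pauli.trace_toMatrix_mul {p q : Pauli} (h : p ≠ q) :
    (p.toMatrix * q.toMatrix).trace = 0 := by
  cases p <;> cases q <;> first | exact absurd rfl h | simp [Pauli.toMatrix, Matrix.trace]

lemma Pauli.X_mul_Y : Pauli.X.toMatrix * Pauli.Y.toMatrix = Complex.I • Pauli.Z.toMatrix := by
  ext i j; fin_cases i <;> fin_cases j <;> simp [Pauli.toMatrix]

lemma Pauli.Y_mul_X : Pauli.Y.toMatrix * Pauli.X.toMatrix = (-Complex.I) • Pauli.Z.toMatrix := by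
  ext i j; fin_cases i <;> fin_cases j <;> simp [Pauli.toMatrix]

lemma Pauli.X_mul_Z : Pauli.X.toMatrix * Pauli.Z.toMatrix = (-Complex.I) • Pauli.Y.toMatrix := by
  ext i j; fin_cases i <;> fin_cases j <;> simp [Pauli.toMatrix]

lemma Pauli.Z_mul_X : Pauli.Z.toMatrix * Pauli.X.toMatrix = Complex.I • Pauli.Y.toMatrix := by
  ext i j; fin_cases i <;> fin_cases j <;> simp [Pauli.toMatrix]

lemma Pauli.Y_mul_Z : Pauli.Y.toMatrix * Pauli.Z.toMatrix = Complex.I • Pauli.X.toMatrix := by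
  ext i j; fin_cases i <;> fin_cases j <;> simp [Pauli.toMatrix]

lemma Pauli.Z_mul_Y : Pauli.Z.toMatrix * Pauli.Y.toMatrix = (-Complex.I) • Pauli.X.toMatrix := by
  ext i j; fin_cases i <;> fin_cases j <;> simp [Pauli.toMatrix]

lemma Pauli.toMatrix_I : Pauli.I.toMatrix = 1 := rfl

lemma Pauli.transpose_X : Pauli.X.toMatrixᵀ = Pauli.X.toMatrix := by
  ext i j; fin_cases i <;> fin_cases j <;> simp [Pauli.toMatrix]

lemma Pauli.transpose_Y : Pauli.Y.toMatrixᵀ = (-1 : ℂ) • Pauli.Y.toMatrix := by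
  ext i j; fin_cases i <;> fin_cases j <;> simp [Pauli.toMatrix]

lemma Pauli.transpose_Z : Pauli.Z.toMatrixᵀ = Pauli.Z.toMatrix := by
  ext i j; fin_cases i <;> fin_cases j <;> simp [Pauli.toMatrix]

/-! ### Pauli strings -/

lemma pauliString_mul_self {n : ℕ} (s : Fin n → Pauli) : pauliString s * pauliString s = 1 := by
  simp only [pauliString_eq_tensor, tensor_mul, Pauli.toMatrix_mul_self, tensor_one]

lemma conjTranspose_pauliString {n : ℕ} (s : Fin n → Pauli) :
    (pauliString s)ᴴ = pauliString s := by
  simp only [pauliString_eq_tensor, conjTranspose_tensor, Pauli.conjTranspose_toMatrix]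

lemma trace_pauliString_mul {n : ℕ} {s t : Fin n → Pauli} (h : s ≠ t) :
    (pauliString s * pauliString t).trace = 0 := by
  obtain ⟨k, hk⟩ := Function.ne_iff.mp h
  simp only [pauliString_eq_tensor, tensor_mul, trace_tensor]
  exact Finset.prod_eq_zero (Finset.mem_univ k) (Pauli.trace_toMatrix_mul hk)

/-- A tensor product of single-qubit relations `M k * M' k = c k • L k` in which only one phase
is not `1`. -/
lemma tensor_mul_eq_smul {n : ℕ} {M M' L : Fin n → Matrix (Fin 2) (Fin 2) ℂ} (i : Fin n) (c : ℂ)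
    (hi : M i * M' i = c • L i) (h : ∀ k, k ≠ i → M k * M' k = L k) :
    tensor M * tensor M' = c • tensor L := by
  have h1 : (fun k => M k * M' k) = fun k => (if k = i then c else 1) • L k := by
    funext k
    by_cases hk : k = i
    · subst hk; simpa using hi
    · simpa [hk] using h k hk
  rw [tensor_mul, h1, tensor_smul]
  simp

/-- A Pauli string that generates a one-parameter subgroup of the matchgate Lie algebra is one of
the standard ones. -/
lemma mem_matchgateStrings_of_mem_lieAlgebra {n : ℕ} {s : Fin n → Pauli}
    (h : Complex.I • pauliString s ∈ matchgateLieAlgebra n) :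
    pauliString s ∈ matchgateStrings n := by
  by_contra hs
  -- Distinct Pauli strings are trace-orthogonal: the trace pairing with `pauliString s` would kill
  -- the whole Lie algebra, yet on `i • pauliString s` it equals `i 2^n`.
  let f : Op n →ₗ[ℝ] ℂ :=
    { toFun := fun M => (pauliString s * M).trace
      map_add' := fun M M' => by rw [Matrix.mul_add, Matrix.trace_add]
      map_smul' := fun c M => by simp }
  have hle : matchgateLieAlgebra n ≤ LinearMap.ker f := by
    refine Submodule.span_le.mpr ?_
    rintro _ ⟨H, hH, rfl⟩
    have key : ∀ t : Fin n → Pauli, H = pauliString t → f (Complex.I • H) = 0 := by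
      rintro t rfl
      have hst : s ≠ t := by rintro rfl; exact hs hH
      change (pauliString s * Complex.I • pauliString t).trace = 0
      rw [Matrix.mul_smul, Matrix.trace_smul, trace_pauliString_mul hst, smul_zero]
    rcases hH with ⟨i, hi⟩ | ⟨A, B, -, -, i, j, -, hH⟩
    · exact key _ hi
    · exact key _ hH
  have h0 : (pauliString s * Complex.I • pauliString s).trace = 0 := hle h
  rw [Matrix.mul_smul, Matrix.trace_smul, pauliString_mul_self, Matrix.trace_one] at h0
  simp at h0

/-! ### Majorana operators -/

/-- Labels of the `2n` Majorana operators. -/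
abbrev Maj (n : ℕ) : Type := Fin n × Bool

/-- The Pauli string `Z_1 ⋯ Z_{i-1} X_i` or `Z_1 ⋯ Z_{i-1} Y_i`. -/
def majString {n : ℕ} (μ : Maj n) : Fin n → Pauli :=
  fun k => if k < μ.1 then Pauli.Z else if k = μ.1 then bif μ.2 then Pauli.Y else Pauli.X
    else Pauli.I

/-- The Majorana operators. -/
def majorana {n : ℕ} (μ : Maj n) : Op n := pauliString (majString μ)

lemma majorana_mul_self {n : ℕ} (μ : Maj n) : majorana μ * majorana μ = 1 :=
  pauliString_mul_self _

lemma conjTranspose_majorana {n : ℕ} (μ : Maj n) : (majorana μ)ᴴ = majorana μ :=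
  conjTranspose_pauliString _

/-- The strings fail to commute at site `i` only, where `X` or `Y` meets the `Z` tail of the later
operator. -/
lemma majorana_anticomm_of_lt {n : ℕ} {i j : Fin n} (h : i < j) (a b : Bool) :
    majorana (i, a) * majorana (j, b) = (-1 : ℂ) • (majorana (j, b) * majorana (i, a)) := by
  simp only [majorana, pauliString_eq_tensor]
  rw [tensor_mul (fun k => (majString (j, b) k).toMatrix)]
  refine tensor_mul_eq_smul i _ ?_ ?_
  · cases a <;>
      simp [majString, h, Pauli.X_mul_Z, Pauli.Z_mul_X, Pauli.Y_mul_Z, Pauli.Z_mul_Y]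
  · intro k hk
    rcases lt_or_gt_of_ne hk with hk' | hk'
    · simp [majString, hk', hk'.trans h]
    · simp [majString, hk, hk'.not_gt, Pauli.toMatrix_I]

lemma majorana_anticomm {n : ℕ} {μ ν : Maj n} (h : μ ≠ ν) :
    majorana μ * majorana ν = -(majorana ν * majorana μ) := by
  obtain ⟨i, a⟩ := μ
  obtain ⟨j, b⟩ := ν
  rcases lt_trichotomy i j with hij | hij | hij
  · simpa using majorana_anticomm_of_lt hij a b
  · subst hij
    have hab : a ≠ b := by rintro rfl; exact h rfl
    rw [← neg_one_smul ℂ]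
    simp only [majorana, pauliString_eq_tensor]
    rw [tensor_mul (fun k => (majString (i, b) k).toMatrix)]
    refine tensor_mul_eq_smul i _ ?_ ?_
    · cases a <;> cases b <;> first
        | exact absurd rfl hab
        | simp [majString, Pauli.X_mul_Y, Pauli.Y_mul_X]
    · intro k hk
      simp [majString, hk]
  · rw [majorana_anticomm_of_lt hij b a]
    simp

/-- `γ γᵀ` is `1` or `-1`, according to the number of factors `Y`. -/
lemma majorana_mul_transpose {n : ℕ} (μ : Maj n) :
    majorana μ * (majorana μ)ᵀ = (bif μ.2 then (-1 : ℂ) else 1) • 1 := by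
  obtain ⟨i, a⟩ := μ
  rw [← tensor_one]
  simp only [majorana, pauliString_eq_tensor, transpose_tensor]
  refine tensor_mul_eq_smul i _ ?_ ?_
  · cases a <;>
      simp [majString, Pauli.transpose_X, Pauli.transpose_Y, Pauli.toMatrix_mul_self]
  · intro k hk
    by_cases hk' : k < i
    · simp [majString, hk', Pauli.transpose_Z, Pauli.toMatrix_mul_self]
    · simp [majString, hk', hk, Pauli.toMatrix_I]

lemma stringZ_eq_majorana {n : ℕ} (i : Fin n) :
    pauliString (stringZ i) = (-Complex.I) • (majorana (i, false) * majorana (i, true)) := by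
  have h : majorana (i, false) * majorana (i, true) = Complex.I • pauliString (stringZ i) := by
    simp only [majorana, pauliString_eq_tensor]
    refine tensor_mul_eq_smul i _ ?_ ?_
    · simp [majString, stringZ, Pauli.X_mul_Y]
    · intro k hk
      simp only [majString, stringZ, hk, if_false, Pauli.toMatrix_I]
      split_ifs <;> simp [Pauli.toMatrix_mul_self, Pauli.toMatrix_I]
  rw [h, smul_smul]
  simp

lemma majorana_mul_majorana_of_lt {n : ℕ} {i j : Fin n} (h : i < j) (a b : Bool) :
    majorana (i, a) * majorana (j, b) = (bif a then Complex.I else -Complex.I) •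
      pauliString (stringHat (bif a then Pauli.X else Pauli.Y)
        (bif b then Pauli.Y else Pauli.X) i j) := by
  simp only [majorana, pauliString_eq_tensor]
  refine tensor_mul_eq_smul i _ ?_ ?_
  -- At site `i` the letter of the first operator meets a `Z` of the second, which flips `X` and `Y`
  -- and produces the only phase; the tails below `i` cancel.
  · cases a <;> simp [majString, stringHat, h, Pauli.X_mul_Z, Pauli.Y_mul_Z]
  · intro k hk
    rcases lt_or_gt_of_ne hk with hk' | hk'
    · simp [majString, stringHat, hk, hk', hk'.trans h, (hk'.trans h).ne, hk'.not_gt,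
        Pauli.toMatrix_mul_self, Pauli.toMatrix_I]
    · rcases lt_trichotomy k j with hkj | hkj | hkj
      · simp [majString, stringHat, hk, hk', hkj, hkj.ne, hk'.not_gt, Pauli.toMatrix_I]
      · subst hkj
        simp [majString, stringHat, hk, hk'.not_gt, Pauli.toMatrix_I]
      · simp [majString, stringHat, hk, hk'.not_gt, hkj.not_gt, hkj.ne', Pauli.toMatrix_I]

lemma stringHat_eq_majorana {n : ℕ} {i j : Fin n} (h : i < j) (a b : Bool) :
    pauliString (stringHat (bif a then Pauli.X else Pauli.Y)
        (bif b then Pauli.Y else Pauli.X) i j) =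
      (bif a then -Complex.I else Complex.I) • (majorana (i, a) * majorana (j, b)) := by
  rw [majorana_mul_majorana_of_lt h, smul_smul]
  cases a <;> simp

/-- The matchgate Pauli strings are, up to a phase `± i`, the products of two distinct Majorana
operators. -/
lemma exists_majorana_of_mem_matchgateStrings {n : ℕ} {H : Op n} (hH : H ∈ matchgateStrings n) :
    ∃ (μ ν : Maj n) (a : ℝ), μ ≠ ν ∧ a ^ 2 = 1 ∧
      H = (Complex.I * a) • (majorana μ * majorana ν) := by
  rcases hH with ⟨i, rfl⟩ | ⟨A, B, hA, hB, i, j, hij, rfl⟩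
  · refine ⟨(i, false), (i, true), -1, by simp, by simp, ?_⟩
    rw [stringZ_eq_majorana]
    simp
  · obtain ⟨a, rfl⟩ : ∃ a : Bool, A = bif a then Pauli.X else Pauli.Y := by
      rcases hA with rfl | rfl
      exacts [⟨true, rfl⟩, ⟨false, rfl⟩]
    obtain ⟨b, rfl⟩ : ∃ b : Bool, B = bif b then Pauli.Y else Pauli.X := by
      rcases hB with rfl | rfl
      exacts [⟨false, rfl⟩, ⟨true, rfl⟩]
    refine ⟨(i, a), (j, b), bif a then -1 else 1, by simp [hij.ne], by cases a <;> simp, ?_⟩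
    rw [stringHat_eq_majorana hij]
    cases a <;> simp

/-! ### Gates -/

lemma map_exp_matrix {n : ℕ} (f : ℂ × ℂ →+* Op n) (hf : Continuous f) (z : ℂ × ℂ) :
    f (NormedSpace.exp z) = NormedSpace.exp (f z) := by
  let : NormedRing (Op n) := Matrix.linftyOpNormedRing
  let : NormedAlgebra ℂ (Op n) := Matrix.linftyOpNormedAlgebra
  exact NormedSpace.map_exp f hf z

/-- The exponential of an involution. -/
lemma gate_eq_cos_add_sin {n : ℕ} (θ : ℝ) {H : Op n} (hH : H * H = 1) :
    gate θ H = (Real.cos θ : ℂ) • 1 + (Complex.I * (Real.sin θ : ℂ)) • H := by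
  -- Functional calculus of an involution: `f` sends `(1, -1)` to `H`, and on `ℂ × ℂ` the
  -- exponential is componentwise.
  let f : ℂ × ℂ →+* Op n :=
    { toFun := fun z => ((z.1 + z.2) / 2) • (1 : Op n) + ((z.1 - z.2) / 2) • H
      map_one' := by simp
      map_zero' := by simp
      map_add' := fun z w => by
        simp only [Prod.fst_add, Prod.snd_add]
        module
      map_mul' := fun z w => by
        simp only [Prod.fst_mul, Prod.snd_mul, Matrix.mul_add, Matrix.add_mul, Matrix.smul_mul,
          Matrix.mul_smul, Matrix.one_mul, Matrix.mul_one, hH]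
        module }
  have hf : Continuous f := by
    change Continuous fun z : ℂ × ℂ =>
      ((z.1 + z.2) / 2) • (1 : Op n) + ((z.1 - z.2) / 2) • H
    fun_prop
  have h1 : f (Complex.I * θ, -(Complex.I * θ)) = (Complex.I * (θ : ℂ)) • H := by
    change ((Complex.I * θ + -(Complex.I * θ)) / 2) • (1 : Op n) +
      ((Complex.I * θ - -(Complex.I * θ)) / 2) • H = _
    module
  have h2 := map_exp_matrix f hf (Complex.I * θ, -(Complex.I * θ))
  rw [h1] at h2
  rw [gate, ← h2]
  change (((NormedSpace.exp (Complex.I * (θ : ℂ), -(Complex.I * (θ : ℂ)))).1 +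
      (NormedSpace.exp (Complex.I * (θ : ℂ), -(Complex.I * (θ : ℂ)))).2) / 2) • (1 : Op n) +
    (((NormedSpace.exp (Complex.I * (θ : ℂ), -(Complex.I * (θ : ℂ)))).1 -
      (NormedSpace.exp (Complex.I * (θ : ℂ), -(Complex.I * (θ : ℂ)))).2) / 2) • H = _
  rw [Prod.fst_exp, Prod.snd_exp, ← Complex.exp_eq_exp_ℂ]
  have e1 : Complex.exp (Complex.I * θ) = Complex.cos θ + Complex.sin θ * Complex.I := by
    rw [mul_comm, Complex.exp_mul_I]
  have e2 : Complex.exp (-(Complex.I * θ)) = Complex.cos θ - Complex.sin θ * Complex.I := by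
    rw [show -(Complex.I * (θ : ℂ)) = (-θ : ℂ) * Complex.I by ring, Complex.exp_mul_I,
      Complex.cos_neg, Complex.sin_neg]
    ring
  simp only [e1, e2, Complex.ofReal_cos, Complex.ofReal_sin]
  module

/-- A rotation in the plane of two Majorana operators. -/
def rotation {n : ℕ} (μ ν : Maj n) (C D : ℂ) : Op n := C • 1 + D • (majorana μ * majorana ν)

/-- Every gate of a non-local matchgate circuit is a rotation. -/
lemma gate_eq_rotation {n : ℕ} (θ a : ℝ) {s : Fin n → Pauli} {μ ν : Maj n}
    (hs : pauliString s = (Complex.I * a) • (majorana μ * majorana ν)) :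
    gate θ (pauliString s) =
      rotation μ ν (Real.cos θ : ℂ) ((-(Real.sin θ * a) : ℝ) : ℂ) := by
  rw [gate_eq_cos_add_sin θ (pauliString_mul_self s), hs, rotation, smul_smul]
  congr 2
  push_cast
  linear_combination (Complex.sin θ * a) * Complex.I_mul_I

lemma rotation_mul_left {n : ℕ} {μ ν : Maj n} (h : μ ≠ ν) (C D : ℂ) :
    rotation μ ν C D * majorana μ = C • majorana μ - D • majorana ν := by
  have h1 : majorana μ * majorana ν * majorana μ = -majorana ν := by
    rw [majorana_anticomm h, Matrix.neg_mul, Matrix.mul_assoc, majorana_mul_self, Matrix.mul_one]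
  rw [rotation, Matrix.add_mul, Matrix.smul_mul, Matrix.smul_mul, h1, Matrix.one_mul]
  module

lemma rotation_mul_right {n : ℕ} (μ ν : Maj n) (C D : ℂ) :
    rotation μ ν C D * majorana ν = C • majorana ν + D • majorana μ := by
  rw [rotation, Matrix.add_mul, Matrix.smul_mul, Matrix.smul_mul, Matrix.mul_assoc,
    majorana_mul_self, Matrix.one_mul, Matrix.mul_one]

lemma left_mul_rotation {n : ℕ} (μ ν : Maj n) (C D : ℂ) :
    majorana μ * rotation μ ν C D = C • majorana μ + D • majorana ν := by
  rw [rotation, Matrix.mul_add, Matrix.mul_smul, Matrix.mul_smul, ← Matrix.mul_assoc,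
    majorana_mul_self, Matrix.one_mul, Matrix.mul_one]

lemma right_mul_rotation {n : ℕ} {μ ν : Maj n} (h : μ ≠ ν) (C D : ℂ) :
    majorana ν * rotation μ ν C D = C • majorana ν - D • majorana μ := by
  have h1 : majorana ν * (majorana μ * majorana ν) = -majorana μ := by
    rw [← Matrix.mul_assoc, majorana_anticomm h.symm, Matrix.neg_mul, Matrix.mul_assoc,
      majorana_mul_self, Matrix.mul_one]
  rw [rotation, Matrix.mul_add, Matrix.mul_smul, Matrix.mul_smul, h1, Matrix.mul_one]
  module

lemma rotation_commute {n : ℕ} {μ ν κ : Maj n} (hμ : κ ≠ μ) (hν : κ ≠ ν) (C D : ℂ) :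
    rotation μ ν C D * majorana κ = majorana κ * rotation μ ν C D := by
  have h1 : majorana μ * majorana ν * majorana κ = majorana κ * (majorana μ * majorana ν) := by
    rw [Matrix.mul_assoc, majorana_anticomm hν.symm, Matrix.mul_neg, ← Matrix.mul_assoc,
      majorana_anticomm hμ.symm, Matrix.neg_mul, neg_neg, Matrix.mul_assoc]
  rw [rotation, Matrix.add_mul, Matrix.mul_add, Matrix.smul_mul, Matrix.smul_mul, h1,
    Matrix.mul_smul, Matrix.mul_smul, Matrix.one_mul, Matrix.mul_one]

lemma rotation_mul_conjTranspose {n : ℕ} {μ ν : Maj n} (h : μ ≠ ν) {C D : ℝ}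
    (hCD : C ^ 2 + D ^ 2 = 1) :
    rotation μ ν (C : ℂ) (D : ℂ) * (rotation μ ν (C : ℂ) (D : ℂ))ᴴ = 1 := by
  have h1 : (rotation μ ν (C : ℂ) (D : ℂ))ᴴ =
      (C : ℂ) • 1 + (D : ℂ) • (majorana ν * majorana μ) := by
    simp [rotation, Matrix.conjTranspose_add, Matrix.conjTranspose_smul,
      Matrix.conjTranspose_mul, conjTranspose_majorana]
  have h2 : majorana μ * majorana ν * (majorana ν * majorana μ) = 1 := by
    rw [Matrix.mul_assoc, ← Matrix.mul_assoc (majorana ν), majorana_mul_self, Matrix.one_mul,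
      majorana_mul_self]
  have h3 : (C : ℂ) ^ 2 + (D : ℂ) ^ 2 = 1 := by exact_mod_cast hCD
  rw [h1, rotation]
  simp only [Matrix.add_mul, Matrix.mul_add, Matrix.smul_mul, Matrix.mul_smul, h2, Matrix.one_mul,
    Matrix.mul_one]
  rw [majorana_anticomm h]
  linear_combination (norm := module) h3 • (1 : Op n)

/-! ### Two copies -/

/-- Operators on two copies of the `n`-qubit system. -/
abbrev Op2 (n : ℕ) : Type := Matrix (Qubits n × Qubits n) (Qubits n × Qubits n) ℂ

/-- The two-copy operator `A ⊗ A`. -/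
def dbl {n : ℕ} (A : Op n) : Op2 n := A ⊗ₖ A

lemma dbl_mul {n : ℕ} (A B : Op n) : dbl (A * B) = dbl A * dbl B :=
  Matrix.mul_kronecker_mul A B A B

lemma dbl_one {n : ℕ} : dbl (1 : Op n) = 1 := Matrix.one_kronecker_one

lemma dbl_smul {n : ℕ} (c : ℂ) (A : Op n) : dbl (c • A) = (c * c) • dbl A := by
  simp [dbl, Matrix.smul_kronecker, Matrix.kronecker_smul, smul_smul]

lemma conjTranspose_dbl {n : ℕ} (A : Op n) : (dbl A)ᴴ = dbl Aᴴ :=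
  Matrix.conjTranspose_kronecker A A

lemma twoCopies_eq_dbl {n : ℕ} (U : UGroup n) : twoCopies U = dbl (U : Op n) := rfl

/-- The commuting involutions `γ_μ ⊗ γ_μ`. -/
def pairing {n : ℕ} (μ : Maj n) : Op2 n := dbl (majorana μ)

lemma pairing_mul_self {n : ℕ} (μ : Maj n) : pairing μ * pairing μ = 1 := by
  rw [pairing, ← dbl_mul, majorana_mul_self, dbl_one]

lemma conjTranspose_pairing {n : ℕ} (μ : Maj n) : (pairing μ)ᴴ = pairing μ := by
  rw [pairing, conjTranspose_dbl, conjTranspose_majorana]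

lemma dbl_neg {n : ℕ} (A : Op n) : dbl (-A) = dbl A := by
  rw [← neg_one_smul ℂ, dbl_smul]
  simp

lemma pairing_commute {n : ℕ} (μ ν : Maj n) : pairing μ * pairing ν = pairing ν * pairing μ := by
  by_cases h : μ = ν
  · rw [h]
  · rw [pairing, pairing, ← dbl_mul, majorana_anticomm h, dbl_neg, dbl_mul]

lemma dbl_rotation_commute {n : ℕ} {μ ν κ : Maj n} (hμ : κ ≠ μ) (hν : κ ≠ ν) (C D : ℂ) :
    dbl (rotation μ ν C D) * pairing κ = pairing κ * dbl (rotation μ ν C D) := by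
  rw [pairing, ← dbl_mul, rotation_commute hμ hν, dbl_mul]

/-- Both products equal `(C² + D²)` times the sum of the two pairings: the cross terms `γ_μ ⊗ γ_ν`
cancel, as for the quadratic form `x² + y²` under a rotation. -/
lemma dbl_rotation_commute_add {n : ℕ} {μ ν : Maj n} (h : μ ≠ ν) (C D : ℂ) :
    dbl (rotation μ ν C D) * (pairing μ + pairing ν) =
      (pairing μ + pairing ν) * dbl (rotation μ ν C D) := by
  rw [Matrix.mul_add, Matrix.add_mul]
  simp only [pairing, ← dbl_mul, rotation_mul_left h, rotation_mul_right, left_mul_rotation,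
    right_mul_rotation h]
  simp only [dbl, sub_eq_add_neg, ← neg_smul, Matrix.add_kronecker, Matrix.kronecker_add,
    Matrix.smul_kronecker, Matrix.kronecker_smul]
  module

/-- Conjugation by a gate commutes with the sum of all pairings. -/
lemma dbl_rotation_commute_sum {n : ℕ} {μ ν : Maj n} (h : μ ≠ ν) (C D : ℂ) :
    dbl (rotation μ ν C D) * ∑ κ, pairing κ = (∑ κ, pairing κ) * dbl (rotation μ ν C D) := by
  have h1 : ∑ κ : Maj n, pairing κ =
      (pairing μ + pairing ν) + ∑ κ ∈ (Finset.univ.erase μ).erase ν, pairing κ := by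
    rw [add_assoc, Finset.add_sum_erase _ _ (by simp [h.symm]),
      Finset.add_sum_erase _ _ (Finset.mem_univ _)]
  rw [h1, Matrix.mul_add, Matrix.add_mul, dbl_rotation_commute_add h, Matrix.mul_sum,
    Matrix.sum_mul]
  congr 1
  refine Finset.sum_congr rfl fun κ hκ => ?_
  simp only [Finset.mem_erase] at hκ
  exact dbl_rotation_commute hκ.2.1 hκ.1 C D

/-- The quarter turn exchanges two pairings. -/
lemma dbl_quarter_rotation_mul {n : ℕ} {μ ν : Maj n} (h : μ ≠ ν) {C a : ℂ} (ha : a ^ 2 = 1) :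
    dbl (rotation μ ν C (a * C)) * pairing μ = pairing ν * dbl (rotation μ ν C (a * C)) ∧
    dbl (rotation μ ν C (a * C)) * pairing ν = pairing μ * dbl (rotation μ ν C (a * C)) := by
  simp only [pairing, ← dbl_mul, rotation_mul_left h, rotation_mul_right, left_mul_rotation,
    right_mul_rotation h]
  -- The two vectors agree up to a scalar `± a`, and doubling squares that scalar to `1`.
  have h1 : C • majorana μ - (a * C) • majorana ν =
      (-a) • (C • majorana ν - (a * C) • majorana μ) := by
    linear_combination (norm := module) -(ha • (C • majorana μ))
  have h2 : C • majorana ν + (a * C) • majorana μ =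
      a • (C • majorana μ + (a * C) • majorana ν) := by
    linear_combination (norm := module) -(ha • (C • majorana ν))
  have h3 : a * a = 1 := by rw [← sq, ha]
  constructor
  · rw [h1, dbl_smul, neg_mul_neg, h3, one_smul]
  · rw [h2, dbl_smul, h3, one_smul]

/-! ### Joint spectral projections of commuting involutions -/

/-- The sign `1` on a set and `-1` off it. -/
def sgn {ι : Type*} [DecidableEq ι] (S : Finset ι) (i : ι) : ℂ := if i ∈ S then 1 else -1

/-- Expand `∏ i, (e i + f i) = 1` with `e i = (1 + q i) / 2` and `f i = (1 - q i) / 2`; the summands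
are the `P S`. -/
lemma exists_spectral_resolution_of_commRing {ι A : Type*} [Fintype ι] [DecidableEq ι]
    [CommRing A] [Algebra ℂ A] (q : ι → A) (hq : ∀ i, q i * q i = 1) :
    ∃ P : Finset ι → A, ∑ S, P S = 1 ∧ ∀ i S, q i * P S = sgn S i • P S := by
  let e : ι → A := fun i => (1 / 2 : ℂ) • (1 + q i)
  let f : ι → A := fun i => (1 / 2 : ℂ) • (1 - q i)
  have hef : ∀ i, e i + f i = 1 := fun i => by simp only [e, f]; module
  have he : ∀ i, q i * e i = e i := fun i => by
    simp only [e, mul_smul_comm, mul_add, hq, mul_one, add_comm]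
  have hf : ∀ i, q i * f i = -f i := fun i => by
    simp only [f, mul_smul_comm, mul_sub, hq, mul_one]
    module
  refine ⟨fun S => (∏ i ∈ S, e i) * ∏ i ∈ Finset.univ \ S, f i, ?_, fun i S => ?_⟩
  · have h := Finset.prod_add e f Finset.univ
    simp only [hef, Finset.prod_const_one, Finset.powerset_univ] at h
    exact h.symm
  · beta_reduce
    by_cases hi : i ∈ S
    · rw [sgn, if_pos hi, one_smul, ← Finset.mul_prod_erase S e hi, ← mul_assoc, ← mul_assoc, he]
    · have hi' : i ∈ Finset.univ \ S := by simp [hi]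
      rw [sgn, if_neg hi, ← Finset.mul_prod_erase _ f hi', mul_left_comm, ← mul_assoc (q i), hf]
      simp

lemma exists_spectral_resolution {ι A : Type*} [Fintype ι] [DecidableEq ι] [Ring A] [Algebra ℂ A]
    (q : ι → A) (hq : ∀ i, q i * q i = 1) (hc : ∀ i j, q i * q j = q j * q i) :
    ∃ P : Finset ι → A, ∑ S, P S = 1 ∧
      ∀ i S, q i * P S = sgn S i • P S ∧ P S * q i = sgn S i • P S := by
  have hcomm : ∀ a ∈ Set.range q, ∀ b ∈ Set.range q, a * b = b * a := by
    rintro _ ⟨i, rfl⟩ _ ⟨j, rfl⟩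
    exact hc i j
  -- Commuting elements generate a commutative subalgebra, where the previous lemma applies.
  let : CommRing (Algebra.adjoin ℂ (Set.range q)) :=
    { (inferInstance : Ring (Algebra.adjoin ℂ (Set.range q))) with
      mul_comm := (Algebra.isMulCommutative_adjoin ℂ hcomm).is_comm.comm }
  let q' : ι → Algebra.adjoin ℂ (Set.range q) := fun i => ⟨q i, Algebra.subset_adjoin ⟨i, rfl⟩⟩
  obtain ⟨P, hP1, hP⟩ := exists_spectral_resolution_of_commRing q' fun i => Subtype.ext (hq i)
  refine ⟨fun S => (P S : A), ?_, fun i S => ⟨?_, ?_⟩⟩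
  · have h := congrArg (Subalgebra.val (Algebra.adjoin ℂ (Set.range q))) hP1
    rw [map_sum, map_one] at h
    exact h
  · exact congrArg (Subalgebra.val (Algebra.adjoin ℂ (Set.range q))) (hP i S)
  · have h := hP i S
    rw [mul_comm] at h
    exact congrArg (Subalgebra.val (Algebra.adjoin ℂ (Set.range q))) h

/-- The joint spectral projections of the pairings. -/
def proj {n : ℕ} (S : Finset (Maj n)) : Op2 n :=
  (exists_spectral_resolution (pairing (n := n)) pairing_mul_self pairing_commute).choose S

lemma sum_proj {n : ℕ} : ∑ S : Finset (Maj n), proj S = 1 :=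
  (exists_spectral_resolution (pairing (n := n)) pairing_mul_self pairing_commute).choose_spec.1

lemma pairing_mul_proj {n : ℕ} (μ : Maj n) (S : Finset (Maj n)) :
    pairing μ * proj S = sgn S μ • proj S :=
  ((exists_spectral_resolution (pairing (n := n)) pairing_mul_self
    pairing_commute).choose_spec.2 μ S).1

lemma proj_mul_pairing {n : ℕ} (μ : Maj n) (S : Finset (Maj n)) :
    proj S * pairing μ = sgn S μ • proj S :=
  ((exists_spectral_resolution (pairing (n := n)) pairing_mul_self
    pairing_commute).choose_spec.2 μ S).2

/-- An operator that intertwines two operators has no matrix elements between eigenspaces with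
distinct eigenvalues. -/
lemma mul_mul_eq_zero_of_eigenvalue_ne {ι : Type*} [Fintype ι] {L W R A B : Matrix ι ι ℂ}
    {a b : ℂ} (h : A * W = W * B) (hL : L * A = a • L) (hR : B * R = b • R) (hab : a ≠ b) :
    L * W * R = 0 := by
  have h1 : a • (L * W * R) = b • (L * W * R) := by
    calc a • (L * W * R) = L * A * W * R := by rw [hL]; simp only [Matrix.smul_mul]
      _ = L * (A * W) * R := by rw [Matrix.mul_assoc L A W]
      _ = L * W * (B * R) := by rw [h]; simp only [Matrix.mul_assoc]
      _ = b • (L * W * R) := by rw [hR, Matrix.mul_smul]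
  rw [← sub_eq_zero, ← sub_smul] at h1
  exact (smul_eq_zero.mp h1).resolve_left (sub_ne_zero.mpr hab)

lemma sgn_eq_sgn_iff {ι : Type*} [DecidableEq ι] {S T : Finset ι} {i j : ι} :
    sgn S i = sgn T j ↔ (i ∈ S ↔ j ∈ T) := by
  unfold sgn
  split_ifs <;> norm_num [*]

lemma exists_sgn_ne {ι : Type*} [DecidableEq ι] {S T : Finset ι} (h : S ≠ T) :
    ∃ i, sgn S i ≠ sgn T i := by
  by_contra! h'
  exact h (Finset.ext fun i => sgn_eq_sgn_iff.mp (h' i))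

lemma eigenvector_mul_eq_zero {n : ℕ} {L R : Op2 n} {S T : Finset (Maj n)}
    (hL : ∀ μ, L * pairing μ = sgn S μ • L) (hR : ∀ μ, pairing μ * R = sgn T μ • R)
    (h : S ≠ T) : L * R = 0 := by
  obtain ⟨μ, hμ⟩ := exists_sgn_ne h
  simpa using mul_mul_eq_zero_of_eigenvalue_ne (W := 1) (by simp) (hL μ) (hR μ) hμ

/-- A joint eigenvector lies in the range of the corresponding projection. -/
lemma proj_mul_eq_self {n : ℕ} {R : Op2 n} {T : Finset (Maj n)}
    (hR : ∀ μ, pairing μ * R = sgn T μ • R) : proj T * R = R := by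
  calc proj T * R = ∑ S, proj S * R :=
        (Finset.sum_eq_single T (fun S _ hS =>
          eigenvector_mul_eq_zero (fun μ => proj_mul_pairing μ S) hR hS) (by simp)).symm
    _ = R := by rw [← Matrix.sum_mul, sum_proj, Matrix.one_mul]

lemma proj_mul_proj_self {n : ℕ} (S : Finset (Maj n)) : proj S * proj S = proj S :=
  proj_mul_eq_self fun μ => pairing_mul_proj μ S

lemma proj_mul_proj_of_ne {n : ℕ} {S T : Finset (Maj n)} (h : S ≠ T) : proj S * proj T = 0 :=
  eigenvector_mul_eq_zero (fun μ => proj_mul_pairing μ S) (fun μ => pairing_mul_proj μ T) h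

lemma star_sgn {ι : Type*} [DecidableEq ι] (S : Finset ι) (i : ι) : star (sgn S i) = sgn S i := by
  unfold sgn
  split_ifs <;> simp

/-- The adjoint satisfies the same eigenvalue relations, so `P * Pᴴ = Pᴴ`; the left side is
self-adjoint, hence so is `P`. -/
lemma conjTranspose_proj {n : ℕ} (S : Finset (Maj n)) : (proj S)ᴴ = proj S := by
  have h1 : proj S * (proj S)ᴴ = (proj S)ᴴ := by
    refine proj_mul_eq_self fun μ => ?_
    have h := congrArg Matrix.conjTranspose (proj_mul_pairing μ S)
    rwa [Matrix.conjTranspose_mul, conjTranspose_pairing, Matrix.conjTranspose_smul,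
      star_sgn] at h
  have h2 := congrArg Matrix.conjTranspose h1
  rw [Matrix.conjTranspose_mul, Matrix.conjTranspose_conjTranspose, h1] at h2
  exact h2

lemma sum_sgn {n : ℕ} (S : Finset (Maj n)) :
    ∑ μ, sgn S μ = 2 * (S.card : ℂ) - 2 * n := by
  have h : ∀ μ, sgn S μ = 2 * (if μ ∈ S then 1 else 0) - 1 := fun μ => by
    unfold sgn; split_ifs <;> norm_num
  simp only [h, Finset.sum_sub_distrib, ← Finset.mul_sum, Finset.sum_ite_mem, Finset.univ_inter]
  simp [mul_comm]

/-- A gate only connects sets of the same size that differ by at most one exchange. -/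
lemma proj_mul_dbl_rotation_mul_proj {n : ℕ} {μ ν : Maj n} (h : μ ≠ ν) (C D : ℂ)
    {S T : Finset (Maj n)} (hne : proj T * dbl (rotation μ ν C D) * proj S ≠ 0) :
    T.card = S.card ∧ (T ∆ S).card ≤ 2 := by
  constructor
  · by_contra hcard
    -- The sum of all pairings acts on the eigenspace of `S` as `2 |S| - 2n`, so it detects the
    -- size.
    refine hne (mul_mul_eq_zero_of_eigenvalue_ne (dbl_rotation_commute_sum h C D).symm
      (a := ∑ κ, sgn T κ) (b := ∑ κ, sgn S κ) ?_ ?_ ?_)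
    · simp only [Matrix.mul_sum, proj_mul_pairing, Finset.sum_smul]
    · simp only [Matrix.sum_mul, pairing_mul_proj, Finset.sum_smul]
    · rw [sum_sgn, sum_sgn]
      intro h'
      apply hcard
      have h'' : (T.card : ℂ) = S.card := by linear_combination h' / 2
      exact_mod_cast h''
  · refine (Finset.card_le_card (t := {μ, ν}) fun κ hκ => ?_).trans Finset.card_le_two
    by_contra hκ'
    simp only [Finset.mem_insert, Finset.mem_singleton, not_or] at hκ'
    -- A label outside `{μ, ν}` has its pairing preserved by the gate, so `S` and `T` agree there.
    refine hne (mul_mul_eq_zero_of_eigenvalue_ne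
      (dbl_rotation_commute hκ'.1 hκ'.2 C D).symm (proj_mul_pairing κ T) (pairing_mul_proj κ S) ?_)
    rw [Ne, sgn_eq_sgn_iff]
    rw [Finset.mem_symmDiff] at hκ
    tauto

/-! ### The maximally entangled state of the two copies -/

/-- The unnormalized maximally entangled vector. -/
def bellVector (n : ℕ) : Qubits n × Qubits n → ℂ := fun p => if p.1 = p.2 then 1 else 0

/-- The maximally entangled state. -/
def bellState (n : ℕ) : Op2 n :=
  ((2 : ℂ) ^ n)⁻¹ • Matrix.vecMulVec (bellVector n) (star (bellVector n))

lemma isState_bellState (n : ℕ) : IsState (bellState n) := by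
  constructor
  · refine (Matrix.posSemidef_vecMulVec_self_star _).smul ?_
    have h : ((2 : ℂ) ^ n)⁻¹ = (((2 : ℝ) ^ n)⁻¹ : ℝ) := by push_cast; rfl
    rw [h]
    exact Complex.zero_le_real.mpr (by positivity)
  · rw [bellState, Matrix.trace_smul, Matrix.trace_vecMulVec]
    simp only [dotProduct, bellVector, Pi.star_apply, Fintype.sum_prod_type]
    simp

/-- The set of Majorana labels whose pairing has eigenvalue `1` on the maximally entangled
state. -/
def bellSet (n : ℕ) : Finset (Maj n) := Finset.univ ×ˢ {false}

lemma card_bellSet (n : ℕ) : (bellSet n).card = n := by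
  simp [bellSet]

lemma dbl_mulVec_bellVector {n : ℕ} (A : Op n) (p : Qubits n × Qubits n) :
    (dbl A).mulVec (bellVector n) p = (A * Aᵀ) p.1 p.2 := by
  simp only [Matrix.mulVec, dotProduct, dbl, bellVector, Fintype.sum_prod_type,
    Matrix.kroneckerMap_apply, Matrix.mul_apply, Matrix.transpose_apply]
  simp

/-- `A ⊗ A` sends the Bell vector to the vectorization of `A Aᵀ`, and `γ γᵀ = ± 1` with the sign
`-1` exactly for the `Y` type. -/
lemma pairing_mul_bellState {n : ℕ} (μ : Maj n) :
    pairing μ * bellState n = sgn (bellSet n) μ • bellState n := by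
  have h1 : (pairing μ).mulVec (bellVector n) = sgn (bellSet n) μ • bellVector n := by
    funext p
    rw [pairing, dbl_mulVec_bellVector, majorana_mul_transpose]
    obtain ⟨i, b⟩ := μ
    cases b <;> simp [sgn, bellSet, bellVector, Matrix.one_apply]
  rw [bellState, Matrix.mul_smul, Matrix.mul_vecMulVec, h1, Matrix.smul_vecMulVec, smul_comm]

lemma proj_mul_bellState_of_ne {n : ℕ} {T : Finset (Maj n)} (h : T ≠ bellSet n) :
    proj T * bellState n = 0 :=
  eigenvector_mul_eq_zero (fun μ => proj_mul_pairing μ T) pairing_mul_bellState h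

/-! ### Circuits -/

/-- Inserting `∑ S, proj S = 1` behind the leftmost gate leaves some intermediate `S` with both
factors nonzero; one more gate then costs one more exchange, that is, `2` in the symmetric
difference. -/
lemma proj_mul_dbl_prod_mul_bellState {n : ℕ} (l : List (Op n))
    (hl : ∀ W ∈ l, ∃ (μ ν : Maj n) (C D : ℂ), μ ≠ ν ∧ W = rotation μ ν C D)
    (T : Finset (Maj n)) (hne : proj T * (dbl l.prod * bellState n) ≠ 0) :
    T.card = n ∧ (T ∆ bellSet n).card ≤ 2 * l.length := by
  induction l generalizing T with
  | nil =>
    rw [List.prod_nil, dbl_one, Matrix.one_mul] at hne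
    have hT : T = bellSet n := by
      by_contra h
      exact hne (proj_mul_bellState_of_ne h)
    simp [hT, card_bellSet]
  | cons W l ih =>
    obtain ⟨μ, ν, C, D, hμν, rfl⟩ := hl W (by simp)
    have h1 : proj T * (dbl (rotation μ ν C D :: l).prod * bellState n) =
        ∑ S, (proj T * dbl (rotation μ ν C D) * proj S) *
          (proj S * (dbl l.prod * bellState n)) := by
      calc _ = proj T * dbl (rotation μ ν C D) * ((∑ S, proj S) * (dbl l.prod * bellState n)) := by
            rw [sum_proj, List.prod_cons, dbl_mul]
            simp only [Matrix.mul_assoc, Matrix.one_mul]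
        _ = _ := by
            rw [Matrix.sum_mul, Matrix.mul_sum]
            refine Finset.sum_congr rfl fun S _ => ?_
            rw [Matrix.mul_assoc _ (proj S) (proj S * _), ← Matrix.mul_assoc (proj S) (proj S),
              proj_mul_proj_self]
    rw [h1] at hne
    obtain ⟨S, -, hS⟩ := Finset.exists_ne_zero_of_sum_ne_zero hne
    obtain ⟨hc, hd⟩ := proj_mul_dbl_rotation_mul_proj hμν C D (left_ne_zero_of_mul hS)
    obtain ⟨hc', hd'⟩ := ih (fun W hW => hl W (by simp [hW])) S (right_ne_zero_of_mul hS)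
    refine ⟨hc.trans hc', ?_⟩
    have hsub : T ∆ bellSet n ⊆ (T ∆ S) ∪ (S ∆ bellSet n) := symmDiff_triangle T S (bellSet n)
    calc (T ∆ bellSet n).card ≤ (T ∆ S).card + (S ∆ bellSet n).card :=
          (Finset.card_le_card hsub).trans (Finset.card_union_le _ _)
      _ ≤ 2 * (l.length + 1) := by omega

/-- The sets of size `n` that arise from the set of the maximally entangled state by at most `N`
exchanges. -/
def ball (n N : ℕ) : Finset (Finset (Maj n)) :=
  Finset.univ.filter fun T => T.card = n ∧ (T ∆ bellSet n).card ≤ 2 * N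

/-- The projection onto the span of the joint eigenspaces labelled by `ball n N`. -/
def ballProj (n N : ℕ) : Op2 n := ∑ T ∈ ball n N, proj T

lemma ballProj_mul_self (n N : ℕ) : ballProj n N * ballProj n N = ballProj n N := by
  simp only [ballProj, Matrix.sum_mul, Matrix.mul_sum]
  refine Finset.sum_congr rfl fun T hT => ?_
  rw [Finset.sum_eq_single T (fun S _ hS => proj_mul_proj_of_ne hS) fun h => absurd hT h,
    proj_mul_proj_self]

lemma conjTranspose_ballProj (n N : ℕ) : (ballProj n N)ᴴ = ballProj n N := by
  simp only [ballProj, Matrix.conjTranspose_sum, conjTranspose_proj]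

lemma IsCircuit.ballProj_mul {n N : ℕ} {U : UGroup n} (hU : IsCircuit n N U) :
    ballProj n N * (twoCopies U * bellState n) = twoCopies U * bellState n := by
  obtain ⟨θ, s, hs, hU⟩ := hU
  have key : ∀ T, T ∉ ball n N → proj T * (twoCopies U * bellState n) = 0 := by
    intro T hT
    by_contra hne
    rw [twoCopies_eq_dbl, hU] at hne
    have h := proj_mul_dbl_prod_mul_bellState _ ?_ T hne
    · rw [List.length_ofFn] at h
      exact hT (Finset.mem_filter.mpr ⟨Finset.mem_univ _, h⟩)
    · intro W hW
      obtain ⟨l, rfl⟩ := (List.mem_ofFn' _ _).mp hW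
      obtain ⟨μ, ν, a, hμν, -, hH⟩ :=
        exists_majorana_of_mem_matchgateStrings (mem_matchgateStrings_of_mem_lieAlgebra (hs l))
      exact ⟨μ, ν, _, _, hμν, gate_eq_rotation _ _ hH⟩
  calc ballProj n N * (twoCopies U * bellState n)
      = ∑ T ∈ ball n N, proj T * (twoCopies U * bellState n) := by rw [ballProj, Matrix.sum_mul]
    _ = ∑ T, proj T * (twoCopies U * bellState n) :=
        Finset.sum_subset (Finset.subset_univ _) fun T _ hT => key T hT
    _ = twoCopies U * bellState n := by rw [← Matrix.sum_mul, sum_proj, Matrix.one_mul]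

/-! ### Expectations in the second moment -/

/-- The expectation of the observable `P` in the state `U^{⊗2} ρ (U†)^{⊗2}`. -/
def expectation {n : ℕ} (P ρ : Op2 n) (U : UGroup n) : ℝ :=
  (P * (twoCopies U * ρ * (twoCopies U)ᴴ)).trace.re

lemma trace_mul_eq_sum {ι : Type*} [Fintype ι] (P X : Matrix ι ι ℂ) :
    (P * X).trace = ∑ a, ∑ b, P a b * X b a := by
  simp only [Matrix.trace, Matrix.diag, Matrix.mul_apply]

lemma trace_conj_eq_sum {n : ℕ} (P ρ : Op2 n) (U : UGroup n) :
    (P * (twoCopies U * ρ * (twoCopies U)ᴴ)).trace =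
      ∑ a, ∑ b, P a b * (twoCopies U * ρ * (twoCopies U)ᴴ) b a :=
  trace_mul_eq_sum _ _

lemma continuous_expectation {n : ℕ} (P ρ : Op2 n) : Continuous (expectation P ρ) := by
  unfold expectation
  simp only [trace_conj_eq_sum]
  exact Complex.continuous_re.comp (continuous_finsetSum _ fun a _ =>
    continuous_finsetSum _ fun b _ => continuous_const.mul (continuous_conj_entry ρ b a))

lemma re_trace_mul_secondMoment {n : ℕ} (E : Measure (UGroup n)) [IsProbabilityMeasure E]
    (P ρ : Op2 n) : (P * secondMoment E ρ).trace.re = ∫ U, expectation P ρ U ∂E := by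
  have hint : ∀ a b, Integrable
      (fun U : UGroup n => P a b * (twoCopies U * ρ * (twoCopies U)ᴴ) b a) E :=
    fun a b => (integrable_conj_entry E ρ b a).const_mul _
  have h1 : (P * secondMoment E ρ).trace =
      ∫ U, (P * (twoCopies U * ρ * (twoCopies U)ᴴ)).trace ∂E := by
    simp only [trace_conj_eq_sum]
    rw [integral_finsetSum _ fun a _ => integrable_finsetSum _ fun b _ => hint a b]
    simp only [integral_finsetSum _ fun b _ => hint _ b, integral_const_mul]
    exact trace_mul_eq_sum _ _
  have h2 : Integrable (fun U : UGroup n => (P * (twoCopies U * ρ * (twoCopies U)ᴴ)).trace) E := by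
    simp only [trace_conj_eq_sum]
    exact integrable_finsetSum _ fun a _ => integrable_finsetSum _ fun b _ => hint a b
  rw [h1]
  exact (integral_re h2).symm

lemma conjTranspose_twoCopies_mul_self {n : ℕ} (U : UGroup n) :
    (twoCopies U)ᴴ * twoCopies U = 1 := by
  rw [twoCopies_eq_dbl, conjTranspose_dbl, ← dbl_mul, ← Matrix.star_eq_conjTranspose,
    Unitary.coe_star_mul_self, dbl_one]

lemma expectation_one {n : ℕ} {ρ : Op2 n} (hρ : IsState ρ) (U : UGroup n) :
    expectation 1 ρ U = 1 := by
  rw [expectation, Matrix.one_mul, Matrix.trace_mul_comm, ← Matrix.mul_assoc,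
    conjTranspose_twoCopies_mul_self, Matrix.one_mul, hρ.2, Complex.one_re]

lemma expectation_sum {n : ℕ} {κ : Type*} (s : Finset κ) (P : κ → Op2 n) (ρ : Op2 n)
    (U : UGroup n) :
    expectation (∑ i ∈ s, P i) ρ U = ∑ i ∈ s, expectation (P i) ρ U := by
  simp only [expectation, Matrix.sum_mul, Matrix.trace_sum, Complex.re_sum]

lemma expectation_proj_nonneg {n : ℕ} (S : Finset (Maj n)) {ρ : Op2 n} (hρ : IsState ρ)
    (U : UGroup n) : 0 ≤ expectation (proj S) ρ U := by
  have h1 := ((hρ.1.mul_mul_conjTranspose_same (twoCopies U)).mul_mul_conjTranspose_same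
    (proj S)).trace_nonneg
  rw [Matrix.trace_mul_comm, conjTranspose_proj, ← Matrix.mul_assoc, proj_mul_proj_self] at h1
  exact (Complex.le_def.mp h1).1

/-! ### The uniform ensemble -/

/-- The weight of the Haar second moment of `ρ` on the joint eigenspace labelled by `S`. -/
def haarWeight {n : ℕ} (ρ : Op2 n) (S : Finset (Maj n)) : ℝ :=
  ∫ U, expectation (proj S) ρ U ∂(haarEnsemble (matchgateGroup n))

lemma haarWeight_nonneg {n : ℕ} {ρ : Op2 n} (hρ : IsState ρ) (S : Finset (Maj n)) :
    0 ≤ haarWeight ρ S :=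
  integral_nonneg fun U => expectation_proj_nonneg S hρ U

lemma integrable_expectation {n : ℕ} (P ρ : Op2 n) (E : Measure (UGroup n))
    [IsFiniteMeasure E] : Integrable (expectation P ρ) E :=
  (continuous_expectation P ρ).integrable_of_hasCompactSupport (HasCompactSupport.of_compactSpace _)

lemma sum_haarWeight_eq {n : ℕ} (ρ : Op2 n) (s : Finset (Finset (Maj n))) :
    ∑ S ∈ s, haarWeight ρ S =
      ∫ U, expectation (∑ S ∈ s, proj S) ρ U ∂(haarEnsemble (matchgateGroup n)) := by
  simp only [expectation_sum, haarWeight]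
  rw [integral_finsetSum _ fun S _ => integrable_expectation _ _ _]

lemma sum_haarWeight {n : ℕ} {ρ : Op2 n} (hρ : IsState ρ) : ∑ S, haarWeight ρ S = 1 := by
  rw [sum_haarWeight_eq, sum_proj]
  simp [expectation_one hρ]

/-- Left translation by `V` preserves Haar measure and turns the expectation of `proj T` into that
of `proj S`. -/
lemma haarWeight_eq_of_intertwine {n : ℕ} (ρ : Op2 n) {S T : Finset (Maj n)} {V : UGroup n}
    (hV : V ∈ matchgateGroup n) (h : proj T * twoCopies V = twoCopies V * proj S) :
    haarWeight ρ T = haarWeight ρ S := by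
  have hmap : ∀ S : Finset (Maj n), haarWeight ρ S =
      ∫ g : matchgateGroup n, expectation (proj S) ρ g
        ∂(Measure.haarMeasure (⊤ : TopologicalSpace.PositiveCompacts (matchgateGroup n))) :=
    fun S => integral_map measurable_subtype_coe.aemeasurable
      (continuous_expectation _ _).aestronglyMeasurable
  have hinv : ∀ U : UGroup n, expectation (proj T) ρ (V * U) = expectation (proj S) ρ U := by
    intro U
    have h2 : twoCopies (V * U) = twoCopies V * twoCopies U := dbl_mul _ _
    have h3 : proj T * (twoCopies V * twoCopies U * ρ * ((twoCopies U)ᴴ * (twoCopies V)ᴴ)) =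
        twoCopies V * (proj S * (twoCopies U * ρ * (twoCopies U)ᴴ)) * (twoCopies V)ᴴ := by
      calc _ = (proj T * twoCopies V) * (twoCopies U * ρ * (twoCopies U)ᴴ) * (twoCopies V)ᴴ := by
            simp only [Matrix.mul_assoc]
        _ = _ := by rw [h]; simp only [Matrix.mul_assoc]
    rw [expectation, expectation, h2, Matrix.conjTranspose_mul, h3, Matrix.trace_mul_comm,
      ← Matrix.mul_assoc, conjTranspose_twoCopies_mul_self, Matrix.one_mul]
  rw [hmap, hmap, ← integral_mul_left_eq_self _ (⟨V, hV⟩ : matchgateGroup n)]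
  exact integral_congr_ae (Filter.Eventually.of_forall fun g => hinv g)

lemma mul_proj_eq_self {n : ℕ} {L : Op2 n} {T : Finset (Maj n)}
    (hL : ∀ μ, L * pairing μ = sgn T μ • L) : L * proj T = L := by
  calc L * proj T = ∑ S, L * proj S :=
        (Finset.sum_eq_single T (fun S _ hS =>
          eigenvector_mul_eq_zero hL (fun μ => pairing_mul_proj μ S) (Ne.symm hS)) (by simp)).symm
    _ = L := by rw [← Matrix.mul_sum, sum_proj, Matrix.mul_one]

/-- An operator that permutes the pairings carries joint eigenspaces to joint eigenspaces. Each of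
the two products is absorbed by the projection on its other side. -/
lemma proj_map_mul {n : ℕ} {V : Op2 n} {σ : Equiv.Perm (Maj n)}
    (h : ∀ μ, V * pairing μ = pairing (σ μ) * V) (S : Finset (Maj n)) :
    proj (S.map σ.toEmbedding) * V = V * proj S := by
  have hs : ∀ μ, sgn (S.map σ.toEmbedding) (σ μ) = sgn S μ := fun μ => by
    rw [sgn_eq_sgn_iff]
    exact Finset.mem_map' σ.toEmbedding
  have h1 : proj (S.map σ.toEmbedding) * (V * proj S) = V * proj S := by
    refine proj_mul_eq_self fun κ => ?_
    obtain ⟨μ, rfl⟩ := σ.surjective κ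
    rw [← Matrix.mul_assoc, ← h, Matrix.mul_assoc, pairing_mul_proj, Matrix.mul_smul, hs]
  have h2 : proj (S.map σ.toEmbedding) * V * proj S = proj (S.map σ.toEmbedding) * V := by
    refine mul_proj_eq_self fun μ => ?_
    rw [Matrix.mul_assoc, h, ← Matrix.mul_assoc, proj_mul_pairing, hs, Matrix.smul_mul]
  rw [← h2, Matrix.mul_assoc, h1]

/-- The quarter turn generated by a matchgate generator exchanges two labels. -/
lemma haarWeight_map_swap_of_generator {n : ℕ} (ρ : Op2 n) {s : Fin n → Pauli} {μ ν : Maj n}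
    {a : ℝ} (hμν : μ ≠ ν) (ha : a ^ 2 = 1)
    (hs : pauliString s = (Complex.I * a) • (majorana μ * majorana ν))
    (hgen : ∀ U : UGroup n, (U : Op n) = gate (Real.pi / 4) (pauliString s) →
      U ∈ matchgateGenerators n) (S : Finset (Maj n)) :
    haarWeight ρ (S.map (Equiv.swap μ ν).toEmbedding) = haarWeight ρ S := by
  have hrot := gate_eq_rotation (Real.pi / 4) a hs
  have hunit : gate (Real.pi / 4) (pauliString s) ∈ Matrix.unitaryGroup (Qubits n) ℂ := by
    rw [Matrix.mem_unitaryGroup_iff, hrot, Matrix.star_eq_conjTranspose]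
    refine rotation_mul_conjTranspose hμν ?_
    rw [neg_sq, mul_pow, ha, mul_one, Real.cos_sq_add_sin_sq]
  let V : UGroup n := ⟨gate (Real.pi / 4) (pauliString s), hunit⟩
  have hV : V ∈ matchgateGroup n :=
    Subgroup.le_topologicalClosure _ (Subgroup.subset_closure (hgen V rfl))
  refine haarWeight_eq_of_intertwine ρ hV (proj_map_mul (fun κ => ?_) S)
  -- `exp (i θ H)` rotates the Majorana plane by `2θ`, so `π / 4` is a quarter turn; `sin = cos`
  -- there gives the form `(C, -a C)`.
  have hVrot : twoCopies V = dbl (rotation μ ν (Real.cos (Real.pi / 4) : ℂ)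
      ((-a : ℂ) * (Real.cos (Real.pi / 4) : ℂ))) := by
    change dbl (gate (Real.pi / 4) (pauliString s)) = _
    rw [hrot, Real.sin_pi_div_four, Real.cos_pi_div_four]
    congr 2
    push_cast
    ring
  have ha' : (-a : ℂ) ^ 2 = 1 := by rw [neg_sq]; exact_mod_cast ha
  rw [hVrot]
  obtain ⟨h1, h2⟩ := dbl_quarter_rotation_mul hμν (C := (Real.cos (Real.pi / 4) : ℂ)) ha'
  by_cases hκμ : κ = μ
  · rw [hκμ, Equiv.swap_apply_left, h1]
  by_cases hκν : κ = ν
  · rw [hκν, Equiv.swap_apply_right, h2]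
  rw [Equiv.swap_apply_of_ne_of_ne hκμ hκν]
  exact dbl_rotation_commute hκμ hκν _ _

lemma haarWeight_map_swap_site {n : ℕ} (ρ : Op2 n) (i : Fin n) (S : Finset (Maj n)) :
    haarWeight ρ (S.map (Equiv.swap (i, false) (i, true)).toEmbedding) = haarWeight ρ S := by
  refine haarWeight_map_swap_of_generator ρ (s := stringZ i) (a := -1) (by simp) (by simp) ?_
    (fun U hU => ⟨_, Or.inl ⟨i, hU⟩⟩) S
  rw [stringZ_eq_majorana]
  simp

lemma haarWeight_map_swap_bond {n : ℕ} (ρ : Op2 n) {i j : Fin n} (hij : (i : ℕ) + 1 = j)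
    (S : Finset (Maj n)) :
    haarWeight ρ (S.map (Equiv.swap (i, true) (j, false)).toEmbedding) = haarWeight ρ S := by
  refine haarWeight_map_swap_of_generator ρ (s := stringHat Pauli.X Pauli.X i j) (a := -1)
    (by simp) (by simp) ?_ (fun U hU => ⟨_, Or.inr ⟨i, j, hij, hU⟩⟩) S
  have hlt : i < j := Fin.lt_def.mpr (by omega)
  simpa using stringHat_eq_majorana hlt true false

/-- Invariance under exchanges is transitive. -/
lemma map_swap_trans {ι β : Type*} [DecidableEq ι] (f : Finset ι → β) {x y z : ι}
    (hxy : ∀ S : Finset ι, f (S.map (Equiv.swap x y).toEmbedding) = f S)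
    (hyz : ∀ S : Finset ι, f (S.map (Equiv.swap y z).toEmbedding) = f S) (S : Finset ι) :
    f (S.map (Equiv.swap x z).toEmbedding) = f S := by
  by_cases h1 : x = y
  · rw [h1]; exact hyz S
  by_cases h2 : x = z
  · rw [h2, Equiv.swap_self]
    congr 1
    ext; simp
  -- `(x z) = (y z)(x y)(y z)`.
  have h3 : S.map (Equiv.swap x z).toEmbedding =
      ((S.map (Equiv.swap y z).toEmbedding).map (Equiv.swap x y).toEmbedding).map
        (Equiv.swap y z).toEmbedding := by
    rw [Equiv.swap_comm x z, ← Equiv.swap_mul_swap_mul_swap h1 h2, Finset.map_map, Finset.map_map]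
    rfl
  rw [h3, hyz, hxy, hyz]

/-- The generators give the transpositions along the path `(0, false), (0, true), (1, false), …`
through all labels; conjugating along the path yields every transposition. -/
lemma haarWeight_map_swap {n : ℕ} (ρ : Op2 n) (μ ν : Maj n) (S : Finset (Maj n)) :
    haarWeight ρ (S.map (Equiv.swap μ ν).toEmbedding) = haarWeight ρ S := by
  have hn : 0 < n := μ.1.pos
  have h0 : ∀ (k : ℕ) (hk : k < n) (S : Finset (Maj n)), haarWeight ρ
      (S.map (Equiv.swap (⟨0, hn⟩, false) (⟨k, hk⟩, false)).toEmbedding) = haarWeight ρ S := by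
    intro k
    induction k with
    | zero =>
      intro hk S
      rw [Equiv.swap_self]
      congr 1
      ext; simp
    | succ k ih =>
      intro hk
      exact map_swap_trans _ (map_swap_trans _ (ih (by omega)) (haarWeight_map_swap_site ρ _))
        (haarWeight_map_swap_bond ρ rfl)
  have h1 : ∀ (κ : Maj n) (S : Finset (Maj n)), haarWeight ρ
      (S.map (Equiv.swap (⟨0, hn⟩, false) κ).toEmbedding) = haarWeight ρ S := by
    rintro ⟨k, b⟩
    cases b
    · exact h0 k k.2
    · exact map_swap_trans _ (h0 k k.2) (haarWeight_map_swap_site ρ k)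
  refine map_swap_trans _ (fun S => ?_) (h1 ν) S
  rw [Equiv.swap_comm]
  exact h1 μ S

lemma haarWeight_map {n : ℕ} (ρ : Op2 n) (σ : Equiv.Perm (Maj n)) (S : Finset (Maj n)) :
    haarWeight ρ (S.map σ.toEmbedding) = haarWeight ρ S := by
  induction σ using Equiv.Perm.swap_induction_on with
  | one =>
    congr 1
    ext
    rw [Finset.mem_map_equiv]
    rfl
  | swap_mul f x y _ ih =>
    rw [← ih, ← haarWeight_map_swap ρ x y (S.map f.toEmbedding), Finset.map_map]
    rfl

lemma exists_perm_map_eq {ι : Type*} [Fintype ι] [DecidableEq ι] {S T : Finset ι}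
    (h : S.card = T.card) : ∃ σ : Equiv.Perm ι, S.map σ.toEmbedding = T := by
  let e : S ≃ T := Finset.equivOfCardEq h
  refine ⟨e.extendSubtype, Finset.eq_of_subset_of_card_le ?_ (by simp [h])⟩
  intro x hx
  obtain ⟨y, hy, rfl⟩ := Finset.mem_map.mp hx
  exact e.extendSubtype_mem y hy

/-- The Haar second moment spreads uniformly over the sets of a given size. -/
lemma haarWeight_mul_choose_le {n : ℕ} {ρ : Op2 n} (hρ : IsState ρ) (S : Finset (Maj n)) :
    (n * 2).choose S.card * haarWeight ρ S ≤ 1 := by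
  rw [← sum_haarWeight hρ]
  calc ((n * 2).choose S.card : ℝ) * haarWeight ρ S
      = ∑ T ∈ Finset.powersetCard S.card (Finset.univ : Finset (Maj n)), haarWeight ρ T := by
        rw [Finset.sum_congr rfl (g := fun _ => haarWeight ρ S), Finset.sum_const,
          Finset.card_powersetCard]
        · simp
        · intro T hT
          obtain ⟨σ, rfl⟩ := exists_perm_map_eq (Finset.mem_powersetCard.mp hT).2.symm
          exact haarWeight_map ρ σ S
    _ ≤ ∑ T, haarWeight ρ T :=
        Finset.sum_le_sum_of_subset_of_nonneg (Finset.subset_univ _)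
          fun T _ _ => haarWeight_nonneg hρ T

/-! ### Lower bounds on the trace norm and the diamond norm -/

lemma conjTranspose_mul_apply_eq_inner {ι : Type*} [Fintype ι] (A B : Matrix ι ι ℂ) (i j : ι) :
    (Aᴴ * B) i j = inner ℂ (WithLp.toLp 2 (A.col i)) (WithLp.toLp 2 (B.col j)) := by
  rw [Matrix.mul_apply, PiLp.inner_apply]
  exact Finset.sum_congr rfl fun k _ => mul_comm _ _

lemma trace_submatrix_equiv {ι κ : Type*} [Fintype ι] [Fintype κ] (e : κ ≃ ι)
    (A : Matrix ι ι ℂ) : (A.submatrix e e).trace = A.trace :=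
  Equiv.sum_comp e fun i => A i i

/-- The trace norm dominates the pairing with every unitary. -/
lemma re_trace_mul_le_traceNorm {ι : Type*} [Fintype ι] [DecidableEq ι] {W : Matrix ι ι ℂ}
    (hW : Wᴴ * W = 1) (A : Matrix ι ι ℂ) : (W * A).trace.re ≤ traceNorm A := by
  let hA := Matrix.isHermitian_conjTranspose_mul_self A
  let V : Matrix ι ι ℂ := hA.eigenvectorUnitary
  have hVV : V * Vᴴ = 1 := by
    rw [← Matrix.star_eq_conjTranspose]
    exact Unitary.coe_mul_star_self hA.eigenvectorUnitary
  have hVV' : Vᴴ * V = 1 := mul_eq_one_comm.mp hVV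
  -- In an eigenbasis `v i` of `Aᴴ A`, the diagonal entry `⟨v i, W A v i⟩` is at most `‖W A v i‖ =
  -- ‖A v i‖`, the `i`-th singular value.
  have hdiag : Vᴴ * (Aᴴ * A) * V = Matrix.diagonal (fun i => (hA.eigenvalues i : ℂ)) := by
    have h := hA.spectral_theorem
    rw [Unitary.conjStarAlgAut_apply, Matrix.star_eq_conjTranspose] at h
    change Aᴴ * A = V * _ * Vᴴ at h
    calc Vᴴ * (Aᴴ * A) * V
        = Vᴴ * (V * Matrix.diagonal (RCLike.ofReal ∘ hA.eigenvalues) * Vᴴ) * V :=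
          congrArg (fun M => Vᴴ * M * V) h
      _ = (Vᴴ * V) * Matrix.diagonal (RCLike.ofReal ∘ hA.eigenvalues) * (Vᴴ * V) := by
          simp only [Matrix.mul_assoc]
      _ = _ := by
          rw [hVV', Matrix.one_mul, Matrix.mul_one]
          rfl
  have htr : (W * A).trace = (Vᴴ * (W * A) * V).trace := by
    rw [Matrix.trace_mul_comm _ V, ← Matrix.mul_assoc, hVV, Matrix.one_mul]
  have hbound : ∀ i, ((Vᴴ * (W * A) * V) i i).re ≤ √(hA.eigenvalues i) := by
    intro i
    set x : EuclideanSpace ℂ ι := WithLp.toLp 2 (V.col i)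
    set y : EuclideanSpace ℂ ι := WithLp.toLp 2 ((W * A * V).col i)
    have h1 : (Vᴴ * (W * A) * V) i i = inner ℂ x y := by
      rw [Matrix.mul_assoc, conjTranspose_mul_apply_eq_inner]
    have h2 : ‖x‖ ^ 2 = 1 := by
      rw [norm_sq_eq_re_inner (𝕜 := ℂ), ← conjTranspose_mul_apply_eq_inner, hVV',
        Matrix.one_apply_eq, RCLike.one_re]
    have h4 : ‖y‖ ^ 2 = hA.eigenvalues i := by
      have h6 : (W * A * V)ᴴ * (W * A * V) = Vᴴ * (Aᴴ * A) * V := by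
        calc (W * A * V)ᴴ * (W * A * V) = Vᴴ * (Aᴴ * ((Wᴴ * W) * A)) * V := by
              simp only [Matrix.conjTranspose_mul, Matrix.mul_assoc]
          _ = _ := by rw [hW, Matrix.one_mul]
      rw [norm_sq_eq_re_inner (𝕜 := ℂ), ← conjTranspose_mul_apply_eq_inner, h6, hdiag,
        Matrix.diagonal_apply_eq]
      exact Complex.ofReal_re _
    have hx1 : ‖x‖ = 1 := by
      rw [← Real.sqrt_sq (norm_nonneg x), h2, Real.sqrt_one]
    rw [h1, ← h4, Real.sqrt_sq (norm_nonneg y)]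
    calc (inner ℂ x y).re ≤ ‖inner ℂ x y‖ := Complex.re_le_norm _
      _ ≤ ‖x‖ * ‖y‖ := norm_inner_le_norm x y
      _ = ‖y‖ := by rw [hx1, one_mul]
  rw [htr, Matrix.trace, Complex.re_sum]
  exact Finset.sum_le_sum fun i _ => hbound i

/-- The diamond norm dominates the trace norm on states, tested against a unitary. -/
lemma ofReal_re_trace_le_diamondNorm {ι : Type*} [Fintype ι] [DecidableEq ι]
    (Φ : Matrix ι ι ℂ →ₗ[ℂ] Matrix ι ι ℂ) {ρ W : Matrix ι ι ℂ} (hρ : IsState ρ)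
    (hW : Wᴴ * W = 1) : ENNReal.ofReal (W * Φ ρ).trace.re ≤ diamondNorm Φ := by
  -- A one-dimensional ancilla suffices for the lower bound.
  let e : ι × Fin 1 ≃ ι := Equiv.prodUnique ι (Fin 1)
  have hρ' : IsState (ρ.submatrix e e) := by
    refine ⟨hρ.1.submatrix e, ?_⟩
    rw [trace_submatrix_equiv, hρ.2]
  have hW' : (W.submatrix e e)ᴴ * W.submatrix e e = 1 := by
    rw [Matrix.conjTranspose_submatrix, Matrix.submatrix_mul_equiv, hW, Matrix.submatrix_one_equiv]
  have hamp : ampliate Φ 1 (ρ.submatrix e e) = (Φ ρ).submatrix e e := rfl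
  have h1 := re_trace_mul_le_traceNorm hW' (ampliate Φ 1 (ρ.submatrix e e))
  rw [hamp, Matrix.submatrix_mul_equiv, trace_submatrix_equiv, ← hamp] at h1
  refine (ENNReal.ofReal_le_ofReal h1).trans ?_
  unfold diamondNorm
  exact le_iSup_of_le 1 (le_iSup_of_le (ρ.submatrix e e) (le_iSup_of_le hρ' le_rfl))

/-! ### The distance between circuit ensembles and the uniform ensemble -/

lemma conjTranspose_reflection_mul_self (n N : ℕ) :
    ((2 : ℂ) • ballProj n N - 1)ᴴ * ((2 : ℂ) • ballProj n N - 1) = 1 := by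
  simp only [Matrix.conjTranspose_sub, Matrix.conjTranspose_smul, conjTranspose_ballProj,
    Matrix.conjTranspose_one, Matrix.sub_mul, Matrix.mul_sub, Matrix.smul_mul, Matrix.mul_smul,
    ballProj_mul_self, Matrix.one_mul, Matrix.mul_one]
  simp only [star_ofNat]
  module

lemma expectation_ballProj_of_isCircuit {n N : ℕ} {U : UGroup n} (hU : IsCircuit n N U) :
    expectation (ballProj n N) (bellState n) U = 1 := by
  rw [← expectation_one (isState_bellState n) U, expectation, expectation, Matrix.one_mul,
    ← Matrix.mul_assoc, hU.ballProj_mul]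

lemma integral_expectation_ballProj_le (n N : ℕ) :
    (n * 2).choose n * ∫ U, expectation (ballProj n N) (bellState n) U
      ∂(haarEnsemble (matchgateGroup n)) ≤ (ball n N).card := by
  rw [ballProj, ← sum_haarWeight_eq, Finset.mul_sum]
  calc ∑ S ∈ ball n N, ((n * 2).choose n : ℝ) * haarWeight (bellState n) S
      ≤ ∑ S ∈ ball n N, 1 := Finset.sum_le_sum fun S hS => by
        have h := haarWeight_mul_choose_le (isState_bellState n) S
        rwa [(Finset.mem_filter.mp hS).2.1] at h
    _ = (ball n N).card := by simp

/-- The test unitary is the reflection `2P - 1`. Both channels preserve the trace, so only `2 Tr P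
(X - Y)` remains; `P` has expectation `1` on circuits and at most the counting ratio under Haar
measure. -/
theorem ofReal_two_sub_card_ball_le_distance {n N : ℕ} (E : Measure (UGroup n))
    [IsProbabilityMeasure E] (hE : IsCircuitEnsemble n N E) :
    ENNReal.ofReal (2 - 2 * ((ball n N).card / (n * 2).choose n)) ≤
      distanceToMatchgateHaar E := by
  have hstate := isState_bellState n
  refine le_trans (ENNReal.ofReal_le_ofReal ?_)
    (ofReal_re_trace_le_diamondNorm _ hstate (conjTranspose_reflection_mul_self n N))
  have hlin : ∀ P X Y : Op2 n, (((2 : ℂ) • P - 1) * (X - Y)).trace.re =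
      2 * ((P * X).trace.re - (P * Y).trace.re) - ((1 * X).trace.re - (1 * Y).trace.re) := by
    intro P X Y
    simp only [Matrix.sub_mul, Matrix.mul_sub, Matrix.smul_mul, Matrix.trace_sub,
      Matrix.trace_smul, Complex.sub_re, smul_eq_mul, Complex.mul_re, Complex.re_ofNat,
      Complex.im_ofNat]
    ring
  have h1 : ∫ U, expectation (ballProj n N) (bellState n) U ∂E = 1 := by
    rw [integral_congr_ae (g := fun _ => 1)
      (hE.mono fun U hU => expectation_ballProj_of_isCircuit hU)]
    simp
  have hchoose : (0 : ℝ) < (n * 2).choose n := by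
    exact_mod_cast Nat.choose_pos (by omega)
  have h2 : ∫ U, expectation (ballProj n N) (bellState n) U ∂(haarEnsemble (matchgateGroup n)) ≤
      (ball n N).card / (n * 2).choose n := by
    rw [le_div_iff₀ hchoose, mul_comm]
    exact integral_expectation_ballProj_le n N
  rw [LinearMap.sub_apply, hlin, re_trace_mul_secondMoment, re_trace_mul_secondMoment,
    re_trace_mul_secondMoment, re_trace_mul_secondMoment, h1]
  simp only [expectation_one hstate, integral_const, probReal_univ, one_smul]
  linarith

/-! ### Counting -/

/-- A Chernoff-type bound: each set in the ball contributes at least `t^(2N)` to the generating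
function of `|S ∆ bellSet n|` over all subsets, which is binomial because `S ↦ S ∆ bellSet n` is a
bijection. -/
lemma card_ball_mul_pow_le (n N : ℕ) {t : ℝ} (ht0 : 0 < t) (ht1 : t ≤ 1) :
    (ball n N).card * t ^ (2 * N) ≤ (1 + t) ^ (2 * n) := by
  have hsum : ∑ S : Finset (Maj n), t ^ (S ∆ bellSet n).card = (1 + t) ^ (2 * n) := by
    have hperm := Equiv.sum_comp
      (Function.Involutive.toPerm (fun S : Finset (Maj n) => S ∆ bellSet n)
        fun S => symmDiff_symmDiff_cancel_right _ _) fun S : Finset (Maj n) => t ^ S.card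
    refine hperm.trans ?_
    have h := Finset.sum_pow_mul_eq_add_pow t 1 (Finset.univ : Finset (Maj n))
    simp only [one_pow, mul_one, Finset.powerset_univ] at h
    rw [h, add_comm]
    simp [mul_comm]
  rw [← hsum]
  calc ((ball n N).card : ℝ) * t ^ (2 * N) = ∑ S ∈ ball n N, t ^ (2 * N) := by simp
    _ ≤ ∑ S ∈ ball n N, t ^ (S ∆ bellSet n).card := Finset.sum_le_sum fun S hS =>
        pow_le_pow_of_le_one ht0.le ht1 (Finset.mem_filter.mp hS).2.2
    _ ≤ ∑ S, t ^ (S ∆ bellSet n).card :=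
        Finset.sum_le_sum_of_subset_of_nonneg (Finset.subset_univ _) fun S _ _ => by positivity

lemma card_ball_div_choose_le {n N : ℕ} (hn : 1 ≤ n) {t : ℝ} (ht0 : 0 < t) (ht1 : t ≤ 1) :
    ((ball n N).card : ℝ) / (n * 2).choose n * t ^ (2 * N) ≤ 2 * n * ((1 + t) ^ 2 / 4) ^ n := by
  have hchoose : (0 : ℝ) < (n * 2).choose n := by
    exact_mod_cast Nat.choose_pos (by omega)
  have hcb : (4 : ℝ) ^ n ≤ 2 * n * (n * 2).choose n := by
    have h := Nat.four_pow_le_two_mul_self_mul_centralBinom n hn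
    rw [Nat.centralBinom_eq_two_mul_choose, mul_comm 2 n] at h
    rw [mul_comm 2 (n : ℝ)]
    exact_mod_cast h
  rw [div_mul_eq_mul_div, div_le_iff₀ hchoose, div_pow, ← pow_mul]
  calc ((ball n N).card : ℝ) * t ^ (2 * N) ≤ (1 + t) ^ (2 * n) := card_ball_mul_pow_le n N ht0 ht1
    _ = (1 + t) ^ (2 * n) / 4 ^ n * 4 ^ n := by field_simp
    _ ≤ (1 + t) ^ (2 * n) / 4 ^ n * (2 * n * (n * 2).choose n) := by gcongr
    _ = _ := by ring

/-! ### Asymptotics -/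

/-- A base `t` for which the generating function bound on `ball n N` beats the central binomial
coefficient when `N ≤ n / c`. -/
lemma exists_log_gap {c : ℝ} (hc : 2 < c) :
    ∃ t : ℝ, 0 < t ∧ t < 1 ∧ Real.log ((1 + t) / 2) - Real.log t / c < 0 := by
  have hc0 : 0 < c := by linarith
  have h2c : 2 / c < 1 := (div_lt_one hc0).mpr hc
  have h2c0 : 0 < 2 / c := by positivity
  obtain ⟨t, ht1, ht2⟩ := exists_between h2c
  have ht0 : 0 < t := h2c0.trans ht1
  refine ⟨t, ht0, ht2, ?_⟩
  -- Any `t` in `(2 / c, 1)` works: `log x ≤ x - 1` and `log t ≥ 1 - 1 / t` reduce the claim to `(1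
  -- - t)(2 - t c) < 0`.
  have h1 := Real.log_le_sub_one_of_pos (show 0 < (1 + t) / 2 by linarith)
  have h2 : (1 - t⁻¹) / c ≤ Real.log t / c := by
    gcongr
    exact Real.one_sub_inv_le_log_of_pos ht0
  have h3 : 2 < t * c := (div_lt_iff₀ hc0).mp ht1
  have h4 : (1 + t) / 2 - 1 - (1 - t⁻¹) / c = (1 - t) * (2 - t * c) / (2 * (t * c)) := by
    field_simp
    ring
  have h5 : (1 - t) * (2 - t * c) / (2 * (t * c)) < 0 :=
    div_neg_of_neg_of_pos (mul_neg_of_pos_of_neg (by linarith) (by linarith)) (by linarith)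
  linarith

/-- With `d` the gap in the exponent, the counting ratio is at most `2n e^(-2dn)`. Half of the decay
absorbs a factor `√n`, whence `b = e^d` and `K = 4 / d`. -/
theorem exists_distance_lower_bound {c : ℝ} (hc : 2 < c) :
    ∃ b : ℝ, 1 < b ∧ ∃ K : ℝ, 0 < K ∧ ∀ n : ℕ, 1 ≤ n → ∀ N : ℕ, (N : ℝ) ≤ n / c →
      ∀ (E : Measure (UGroup n)) [IsProbabilityMeasure E], IsCircuitEnsemble n N E →
        ENNReal.ofReal (2 - K * (√(n : ℝ) * b ^ (-(n : ℝ)))) ≤ distanceToMatchgateHaar E := by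
  obtain ⟨t, ht0, ht1, hd⟩ := exists_log_gap hc
  obtain ⟨d, hd'⟩ : ∃ d, d = -(Real.log ((1 + t) / 2) - Real.log t / c) := ⟨_, rfl⟩
  have hd0 : 0 < d := by linarith
  refine ⟨Real.exp d, Real.one_lt_exp_iff.mpr hd0, 4 / d, by positivity, ?_⟩
  intro n hn N hN E _ hE
  refine le_trans (ENNReal.ofReal_le_ofReal ?_) (ofReal_two_sub_card_ball_le_distance E hE)
  have hn0 : (1 : ℝ) ≤ n := by exact_mod_cast hn
  have h1 := card_ball_div_choose_le (N := N) hn ht0 ht1.le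
  have h2 : ((1 + t) ^ 2 / 4) ^ n = Real.exp (2 * n * Real.log ((1 + t) / 2)) := by
    rw [mul_comm 2 (n : ℝ), mul_assoc, Real.exp_nat_mul, two_mul, Real.exp_add,
      Real.exp_log (by linarith)]
    congr 1
    ring
  have h3 : Real.exp (2 * n * (Real.log t / c)) ≤ t ^ (2 * N) := by
    rw [← Real.exp_log (pow_pos ht0 _), Real.log_pow]
    refine Real.exp_le_exp.mpr ?_
    -- `log t < 0` reverses `N ≤ n / c`.
    have h := mul_le_mul_of_nonpos_right hN (Real.log_neg ht0 ht1).le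
    push_cast
    calc 2 * n * (Real.log t / c) = 2 * (n / c * Real.log t) := by ring
      _ ≤ 2 * (N * Real.log t) := by linarith
      _ = _ := by ring
  have h4 : ((ball n N).card : ℝ) / (n * 2).choose n ≤ 2 * n * Real.exp (-(2 * d * n)) := by
    have h5 : ((ball n N).card : ℝ) / (n * 2).choose n * Real.exp (2 * n * (Real.log t / c)) ≤
        2 * n * Real.exp (2 * n * Real.log ((1 + t) / 2)) := by
      rw [← h2]
      exact (mul_le_mul_of_nonneg_left h3 (by positivity)).trans h1
    rw [← le_div_iff₀ (Real.exp_pos _), mul_div_assoc, ← Real.exp_sub] at h5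
    refine h5.trans_eq ?_
    congr 2
    rw [hd']
    ring
  -- From `√n ≤ n` and `d n ≤ e^(dn)`; this bounds one of the two factors `√n e^(-dn)` in `n
  -- e^(-2dn)`.
  have h5 : √(n : ℝ) * Real.exp (-(d * n)) ≤ 1 / d := by
    have h6 : √(n : ℝ) ≤ n := Real.sqrt_le_iff.mpr ⟨by linarith, by nlinarith⟩
    have h7 : d * n ≤ Real.exp (d * n) := by linarith [Real.add_one_le_exp (d * n)]
    rw [Real.exp_neg, ← div_eq_mul_inv, div_le_div_iff₀ (Real.exp_pos _) hd0]
    nlinarith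
  have h6 : Real.exp d ^ (-(n : ℝ)) = Real.exp (-(d * n)) := by
    rw [← Real.exp_mul]
    congr 1
    ring
  have h7 : Real.exp (-(2 * d * n)) = Real.exp (-(d * n)) * Real.exp (-(d * n)) := by
    rw [← Real.exp_add]
    congr 1
    ring
  have h8 : (n : ℝ) = √(n : ℝ) * √(n : ℝ) := (Real.mul_self_sqrt (by linarith)).symm
  have h9 : 2 * n * Real.exp (-(2 * d * n)) ≤ 2 / d * (√(n : ℝ) * Real.exp (-(d * n))) := by
    rw [h7]
    calc 2 * n * (Real.exp (-(d * n)) * Real.exp (-(d * n)))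
        = 2 * (√(n : ℝ) * √(n : ℝ)) * (Real.exp (-(d * n)) * Real.exp (-(d * n))) := by rw [← h8]
      _ = 2 * (√(n : ℝ) * Real.exp (-(d * n))) * (√(n : ℝ) * Real.exp (-(d * n))) := by ring
      _ ≤ 2 * (1 / d) * (√(n : ℝ) * Real.exp (-(d * n))) := by gcongr
      _ = _ := by ring
  rw [h6]
  have h10 : 4 / d * (√(n : ℝ) * Real.exp (-(d * n))) =
      2 * (2 / d * (√(n : ℝ) * Real.exp (-(d * n)))) := by ring
  linarith

lemma tendsto_sqrt_mul_rpow_neg {b : ℝ} (hb : 1 < b) (K : ℝ) :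
    Filter.Tendsto (fun n : ℕ => K * (√(n : ℝ) * b ^ (-(n : ℝ)))) Filter.atTop (𝓝 0) := by
  have hb0 : 0 < b := by linarith
  have h1 := tendsto_self_mul_const_pow_of_lt_one (inv_nonneg.mpr hb0.le) (inv_lt_one_of_one_lt₀ hb)
  rw [← mul_zero K]
  refine Filter.Tendsto.const_mul K (squeeze_zero (fun n => by positivity) (fun n => ?_) h1)
  rw [Real.rpow_neg hb0.le, Real.rpow_natCast, inv_pow]
  gcongr
  refine Real.sqrt_le_iff.mpr ⟨by positivity, ?_⟩
  exact_mod_cast Nat.le_self_pow two_ne_zero n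

end Matchgate

end

/-- Sublinear-gate-count ensembles of non-local matchgate circuits do not approximate the second
moment of the matchgate Haar measure. -/
theorem corollary8 :
    -- for at most `n / c` gates, `c > 2`, the diamond distance is at least `2 - O(√n b⁻ⁿ)`
    (∀ c : ℝ, 2 < c → ∃ b : ℝ, 1 < b ∧ ∃ K : ℝ, 0 < K ∧
      ∀ n : ℕ, 1 ≤ n → ∀ N : ℕ, (N : ℝ) ≤ n / c →
        ∀ (E : MeasureTheory.Measure (Matchgate.UGroup n))
          [MeasureTheory.IsProbabilityMeasure E],
          Matchgate.IsCircuitEnsemble n N E →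
            ENNReal.ofReal (2 - K * (√(n : ℝ) * b ^ (-(n : ℝ)))) ≤
              Matchgate.distanceToMatchgateHaar E) ∧
    -- for a sublinear number of gates there is no `ε`-approximate 2-design, for any `ε < 2`
    (∀ N : ℕ → ℕ,
      (fun n => (N n : ℝ)) =o[Filter.atTop] (fun n => (n : ℝ)) →
        ∀ ε : ℝ, ε < 2 → ∀ᶠ n in Filter.atTop,
          ∀ (E : MeasureTheory.Measure (Matchgate.UGroup n))
            [MeasureTheory.IsProbabilityMeasure E],
            Matchgate.IsCircuitEnsemble n (N n) E →
              ¬ Matchgate.IsApproxTwoDesign (Matchgate.matchgateGroup n) E ε) := by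
  refine ⟨fun c hc => Matchgate.exists_distance_lower_bound hc, fun N hN ε hε => ?_⟩
  -- Any `c > 2` would serve.
  obtain ⟨b, hb, K, -, hbound⟩ :=
    Matchgate.exists_distance_lower_bound (c := 3) (by norm_num)
  have hlim := Matchgate.tendsto_sqrt_mul_rpow_neg hb K
  filter_upwards [hN.bound (c := 1 / 3) (by norm_num), Filter.eventually_ge_atTop 1,
    hlim.eventually_lt_const (sub_pos.mpr hε), hlim.eventually_lt_const (two_pos)]
    with n hNn hn h1 h2 E _ hE hdesign
  have hNn' : (N n : ℝ) ≤ n / 3 := by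
    rw [Real.norm_of_nonneg (Nat.cast_nonneg _), Real.norm_of_nonneg (Nat.cast_nonneg _)] at hNn
    linarith
  have h3 : ENNReal.ofReal (2 - K * (√(n : ℝ) * b ^ (-(n : ℝ)))) ≤ ENNReal.ofReal ε :=
    (hbound n hn (N n) hNn' E hE).trans hdesign
  -- `ENNReal.ofReal` truncates at `0`, so strictness also needs a positive right side: this is
  -- `h2`, relevant when `ε` is negative.
  have h4 : ENNReal.ofReal ε < ENNReal.ofReal (2 - K * (√(n : ℝ) * b ^ (-(n : ℝ)))) :=
    (ENNReal.ofReal_lt_ofReal_iff (by linarith)).mpr (by linarith)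
  exact absurd h3 h4.not_ge
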